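/- Let $\Gamma$ be a finite simplicial graph and let $G(\Gamma)$ be the right-angled Artin group with generating set the vertices of $\Gamma$ and a defining relation $ab=ba$ for each pair of adjacent vertices $a,b$. Let $X(\Gamma)$ be the universal cover of the Salvetti complex of $G(\Gamma)$; its vertices are identified with the elements of $G(\Gamma)$, with edges labelled $a$ joining $g$ to $ga$. The standard flats of $X(\Gamma)$ are the subcomplexes spanned by the cosets $g\langle K\rangle$, where $g\in G(\Gamma)$ and $K$ is the vertex set of a complete subgraph of $\Gamma$ (possibly empty); a standard geodesic is a standard flat $g\langle a\rangle$ with $a$ a single vertex. A maximal standard flat is a standard flat that is maximal under inclusion. Let $\mathcal P(\Gamma)$ be the extension complex of $\Gamma$: it is the flag complex of the extension graph, the graph whose vertices are the conjugates $gag^{-1}\in G(\Gamma)$ of the standard generators $a$, two distinct vertices being adjacent if they commute. The standard geodesic $g\langle a\rangle$ determines the vertex $gag^{-1}$ of $\mathcal P(\Gamma)$. For a standard flat $F$, let $\Delta(F)$ be the set of vertices of $\mathcal P(\Gamma)$ determined by the standard geodesics contained in $F$; it is the vertex set of a simplex (empty if $F$ is a point). For a vertex $x$ of $X(\Gamma)$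 let $(F(\Gamma))_x$ be the full subcomplex of $\mathcal P(\Gamma)$ spanned by the vertices determined by the standard geodesics through $x$; it is a copy of the flag complex $F(\Gamma)$ of $\Gamma$. For a vertex $v$ of a graph or of a simplicial complex, $lk(v)$ denotes the full subcomplex spanned by the vertices adjacent to $v$, and the closed star $St(v)$ the full subcomplex spanned by $v$ and the vertices adjacent to $v$. A full subcomplex $S$ separates a full subcomplex $Y$ if $Y\setminus S$ is disconnected (the empty set is regarded as connected). The graph $\Gamma$ is of weak type II if it is connected and for all vertices $v,w$ with $d(v,w)=2$ the graph $\Gamma\setminus(lk(v)\cap lk(w))$ is connected. $\Gamma$, and likewise $G(\Gamma)$, is of weak type I if $\Gamma$ is of weak type II and $St(v)$ does not separate $\Gamma$ for any vertex $v$ of $\Gamma$. A simplicial automorphism $s$ of $\mathcal P(\Gamma)$ is visible if for every vertex $p$ of $X(\Gamma)$ the following holds: let $F_1,\dots,F_n$ be the maximal standard flats containing $p$, and let $F_i'$ be the (unique) maximal standard flat with $\Delta(F_i')=s(\Delta(F_i))$; then $\bigcap_{i=1}^n F_i'\neq\emptyset$. Theorem. The following are equivalent: (1) $G(\Gamma)$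 is of weak type I. (2) There do not exist a vertex $x$ of $X(\Gamma)$ and a vertex $v$ of $\mathcal P(\Gamma)$ such that $St(v)$ separates $(F(\Gamma))_x$. (3) Every simplicial automorphism of $\mathcal P(\Gamma)$ is visible. -/

import Mathlib

namespace RAAG

universe u w

/-! ### Connectivity of graphs, closed stars and the two conditions on the defining graph -/

section Graphs

variable {V : Type u} (A : SimpleGraph V)

/-- The vertex set of the closed star `St(v)`: the vertex `v` together with its neighbours. -/
def closedStar (v : V) : Set V := {x | x = v ∨ A.Adj v x}

/-- `S` separates the full subgraph of `A` spanned by the vertex set `Y`: removing the vertices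
in `S` from this subgraph leaves a disconnected graph, that is, there are two vertices of `Y \ S`
which are not joined by any path inside `Y \ S`. (The empty graph is not disconnected.)
If `A` is the 1-skeleton of a simplicial complex and `Y`, `S` span full subcomplexes, then the
components of the complement of one subcomplex in the other correspond to the components of this
graph. -/
def Separates (S Y : Set V) : Prop := ¬ (A.induce (Y \ S)).Preconnected

/-- Weak type II: the graph is connected, and deleting the common link of two vertices at distance
two never disconnects it. (By convention the empty graph is connected.) -/
def IsWeakTypeII : Prop :=
  A.Preconnected ∧
    ∀ v w : V, A.dist v w = 2 → ¬ Separates A (A.neighborSet v ∩ A.neighborSet w) Set.univ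

/-- Weak type I: weak type II, and no closed star of a vertex separates the graph. -/
def IsWeakTypeI : Prop :=
  IsWeakTypeII A ∧ ∀ v : V, ¬ Separates A (closedStar A v) Set.univ

/-- The flag complex of a graph: its simplices are the nonempty finite cliques. -/
def flagComplex : AbstractSimplicialComplex V where
  faces := {s | s.Nonempty ∧ A.IsClique (s : Set V)}
  isRelLowerSet_faces := by
    intro s hs
    refine ⟨hs.1, ?_⟩
    intro t hts ht
    exact ⟨ht, hs.2.subset (by exact_mod_cast hts)⟩
  singleton_mem := by
    intro v
    simp [SimpleGraph.isClique_iff]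

end Graphs

/-- A simplicial isomorphism: a bijection between the vertex sets such that a finite set of
vertices spans a simplex exactly when its image does. -/
structure SimplicialIso {V : Type u} {W : Type w}
    (K : AbstractSimplicialComplex V) (L : AbstractSimplicialComplex W) extends V ≃ W where
  map_mem_faces : ∀ s : Finset V, s.map toEquiv.toEmbedding ∈ L.faces ↔ s ∈ K.faces

section Groups

variable {V : Type u} (Γ : SimpleGraph V)

/-- The defining relations: the generators attached to adjacent vertices commute. -/
def relations : Set (FreeGroup V) :=
  {r | ∃ a b : V, Γ.Adj a b ∧
    r = FreeGroup.of a * FreeGroup.of b * (FreeGroup.of a)⁻¹ * (FreeGroup.of b)⁻¹}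

/-- The right-angled Artin group `G(Γ)`. Its elements are also the vertices of `X(Γ)`, the
universal cover of the Salvetti complex, on which it acts by left multiplication; two vertices `g`
and `h` of `X(Γ)` are joined by an edge labelled `a` when `h = g * a` or `g = h * a`. -/
abbrev Grp : Type u := PresentedGroup (relations Γ)

/-- The standard generator attached to a vertex of `Γ`. -/
def gen (a : V) : Grp Γ := PresentedGroup.of a

/-- The vertex set of the standard subcomplex of `X(Γ)` through the vertex `g` whose support is
the full subgraph spanned by `K`: the left coset `g ⟨K⟩`. -/
def standardSubcomplex (g : Grp Γ) (K : Set V) : Set (Grp Γ) :=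
  {h | g⁻¹ * h ∈ Subgroup.closure (gen Γ '' K)}

/-- `F` is (the vertex set of) a standard flat: a standard subcomplex supported on a complete
subgraph. Standard flats are full subcomplexes of `X(Γ)`, hence are determined by their vertices,
and a family of them has a common point if and only if it has a common vertex. -/
def IsStandardFlat (F : Set (Grp Γ)) : Prop :=
  ∃ (g : Grp Γ) (K : Set V), Γ.IsClique K ∧ F = standardSubcomplex Γ g K

/-- A maximal standard flat: a standard flat not properly contained in another one. -/
def IsMaximalStandardFlat (F : Set (Grp Γ)) : Prop := Maximal (IsStandardFlat Γ) F

/-- The vertex set of the standard geodesic labelled `a` through the vertex `g`. -/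
def standardGeodesic (g : Grp Γ) (a : V) : Set (Grp Γ) := standardSubcomplex Γ g {a}

/-- The vertices of the extension graph: the conjugates in `G(Γ)` of the standard generators. -/
def ExtVertex : Type u := {x : Grp Γ // ∃ (g : Grp Γ) (a : V), x = g * gen Γ a * g⁻¹}

/-- The extension graph: two distinct conjugates of standard generators are adjacent when they
commute. It is the 1-skeleton of the extension complex `P(Γ)`. -/
def extensionGraph : SimpleGraph (ExtVertex Γ) where
  Adj x y := x ≠ y ∧ Commute x.1 y.1
  symm := ⟨fun _ _ h => ⟨h.1.symm, h.2.symm⟩⟩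
  loopless := ⟨fun _ h => h.1 rfl⟩

/-- The extension complex `P(Γ)`, the flag complex of the extension graph. -/
def extensionComplex : AbstractSimplicialComplex (ExtVertex Γ) :=
  flagComplex (extensionGraph Γ)

/-- The vertex of `P(Γ)` attached to the standard geodesic labelled `a` through `g`: the element
of `G(Γ)` translating this geodesic by one edge in the positive direction. Two standard geodesics
are parallel if and only if they have the same vertex of `P(Γ)`. -/
def vertexOfGeodesic (g : Grp Γ) (a : V) : ExtVertex Γ := ⟨g * gen Γ a * g⁻¹, g, a, rfl⟩

/-- The vertex set of `Δ(F)`: the vertices of `P(Γ)` attached to the standard geodesics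
contained in `F`. -/
def delta (F : Set (Grp Γ)) : Set (ExtVertex Γ) :=
  {v | ∃ (g : Grp Γ) (a : V), standardGeodesic Γ g a ⊆ F ∧ v = vertexOfGeodesic Γ g a}

/-- The vertex set of the lifted copy `(F(Γ))ₓ` of the flag complex of `Γ` in `P(Γ)`: the vertices
attached to the standard geodesics through the vertex `x` of `X(Γ)`. The lifted copy is the full
subcomplex of `P(Γ)` spanned by these vertices. -/
def liftedCopy (x : Grp Γ) : Set (ExtVertex Γ) := Set.range (vertexOfGeodesic Γ x)

end Groups

/-- A simplicial isomorphism `s : P(Γ) → P(Γ')` is visible if for every vertex `p` of `X(Γ)` the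
maximal standard flats `F'` of `X(Γ')` with `Δ(F') = s(Δ(F))`, where `F` runs over the maximal
standard flats containing `p`, have a common point. -/
def IsVisible {V : Type u} {W : Type w} {Γ : SimpleGraph V} {Γ' : SimpleGraph W}
    (s : SimplicialIso (extensionComplex Γ) (extensionComplex Γ')) : Prop :=
  ∀ p : Grp Γ, ∃ q : Grp Γ', ∀ F : Set (Grp Γ), IsMaximalStandardFlat Γ F → p ∈ F →
    ∃ F' : Set (Grp Γ'), IsMaximalStandardFlat Γ' F' ∧
      delta Γ' F' = s.toEquiv '' delta Γ F ∧ q ∈ F'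

end RAAG

/-!
The proof rests on the projections of `X(Γ)` to its standard geodesics, obtained without normal
forms. A cocycle on the edges of `X(Γ)` whose sum around each square vanishes has a potential
(`RAAG.exists_potential`), and the potential `RAAG.wall a` counts with signs the hyperplanes dual to
`⟨a⟩` which separate a point from `1`. It shows that the centralizer of `a` is `⟨St(a)⟩`, so that the
union of the geodesics representing a vertex `y` of `P(Γ)`, the parallel set of `y`, is a coset of
`⟨St(b)⟩`, where `b` is the label of `y`. The following facts carry the theorem.

* If `y` is not in the star of `v`, its parallel set projects to a single point of the geodesic of
  `v` (`RAAG.ExtVertex.proj_eq`); parallel sets of adjacent vertices meet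
  (`RAAG.ExtVertex.exists_common`). So the projection is constant along paths outside of `St(v)`.
* Disjoint parallel sets are separated by a hyperplane crossing neither of them
  (`RAAG.ExtVertex.exists_proj_ne`): take the first edge of a shortest path between them.
* Finitely many pairwise intersecting parallel sets have a common point (`RAAG.helly`), by means of
  the retractions onto standard subgroups.

(1) ⇔ (2): after a translation, `St(v)` cuts out of the lifted copy the set of the vertices `b` of
`Γ` that commute with a conjugate `gag⁻¹`. It is `St(a)` for `g = 1`, and `lk(a) ∩ lk(c)` for `g = c`
not adjacent to `a`. For a shortest `g` in general it is the set of vertices commuting with `a` and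
with all letters of `g`, and its complement is a union of connected graphs, each meeting the next
(`RAAG.not_separates_of_isShortest`).

(2) ⇒ (3): let `s` be an automorphism and `p` a vertex of `X(Γ)`. If the parallel sets of two
vertices in `s((F(Γ))ₚ)` were disjoint, they would have different projections to the geodesic of
some `v` whose star contains neither; but the two vertices are joined by a path outside of `St(v)`,
since `St(s⁻¹(v))` does not separate `(F(Γ))ₚ`. So these parallel sets have a common point, which
lies in all the image flats.

(3) ⇒ (2): if the star of `v` separates the lifted copy, a union of components of the complement
extends to a locally constant function on `P(Γ) \ St(v)` (`RAAG.exists_locally_constant`). Together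
with the projection it defines a set `B` of vertices which is disjoint from `vBv⁻¹`, and exchanging
these two sets by conjugation is an automorphism (`RAAG.exists_exchange`). It moves one part of the
lifted copy along the geodesic of `v` and fixes another part, so it is not visible.
-/

namespace RAAG

universe u

/-! ### Standard subgroups and homomorphisms out of the group -/

section Basics

variable {V : Type u} (Γ : SimpleGraph V)

/-- The standard subgroup `⟨K⟩` generated by the vertices in `K`. -/
def std (K : Set V) : Subgroup (Grp Γ) := Subgroup.closure (gen Γ '' K)

variable {Γ}

theorem gen_mem_std {K : Set V} {a : V} (h : a ∈ K) : gen Γ a ∈ std Γ K :=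
  Subgroup.subset_closure ⟨a, h, rfl⟩

theorem std_mono {K L : Set V} (h : K ⊆ L) : std Γ K ≤ std Γ L :=
  Subgroup.closure_mono (Set.image_mono h)

/-- Induction over a standard subgroup, one generator on the right at a time. -/
@[elab_as_elim]
theorem std_induction {K : Set V} {P : Grp Γ → Prop} {z : Grp Γ} (hz : z ∈ std Γ K) (one : P 1)
    (mul : ∀ z ∈ std Γ K, ∀ c ∈ K, (P z ↔ P (z * gen Γ c))) : P z := by
  induction hz using Subgroup.closure_induction_right with
  | one => exact one
  | mul_right x hx y hy ih =>
    obtain ⟨c, hc, rfl⟩ := hy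
    exact (mul x hx c hc).1 ih
  | mul_inv_cancel x hx y hy ih =>
    obtain ⟨c, hc, rfl⟩ := hy
    refine (mul _ ((std Γ K).mul_mem hx ((std Γ K).inv_mem (gen_mem_std hc))) c hc).2 ?_
    simpa using ih

theorem mem_std_univ (z : Grp Γ) : z ∈ std Γ Set.univ := by
  have h : std Γ Set.univ = ⊤ := by
    rw [std, Set.image_univ]
    exact PresentedGroup.closure_range_of (relations Γ)
  rw [h]
  trivial

theorem grp_induction {P : Grp Γ → Prop} (one : P 1)
    (mul : ∀ z c, (P z ↔ P (z * gen Γ c))) (z : Grp Γ) : P z :=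
  std_induction (mem_std_univ z) one fun z _ c _ => mul z c

theorem commute_gen_of_adj {a b : V} (h : Γ.Adj a b) : Commute (gen Γ a) (gen Γ b) := by
  have h1 : PresentedGroup.mk (relations Γ)
      (FreeGroup.of a * FreeGroup.of b * (FreeGroup.of a)⁻¹ * (FreeGroup.of b)⁻¹) = 1 :=
    PresentedGroup.one_of_mem ⟨a, b, h, rfl⟩
  simp only [map_mul, map_inv] at h1
  change gen Γ a * gen Γ b * (gen Γ a)⁻¹ * (gen Γ b)⁻¹ = 1 at h1
  rw [mul_inv_eq_one, mul_inv_eq_iff_eq_mul] at h1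
  exact h1

variable (Γ) in
/-- The homomorphism out of `G(Γ)` sending the generators to elements that commute whenever the
generators are required to. -/
def liftHom {H : Type*} [Group H] (f : V → H) (hf : ∀ a b, Γ.Adj a b → Commute (f a) (f b)) :
    Grp Γ →* H :=
  PresentedGroup.toGroup (f := f) (by
    rintro r ⟨a, b, hab, rfl⟩
    simp only [map_mul, map_inv, FreeGroup.lift_apply_of]
    rw [mul_inv_eq_one, mul_inv_eq_iff_eq_mul]
    exact hf a b hab)

@[simp]
theorem liftHom_gen {H : Type*} [Group H] (f : V → H)
    (hf : ∀ a b, Γ.Adj a b → Commute (f a) (f b)) (a : V) : liftHom Γ f hf (gen Γ a) = f a :=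
  PresentedGroup.toGroup.of _

open Classical in
variable (Γ) in
/-- The total exponent of the generator `b`. -/
noncomputable def expSum (b : V) : Grp Γ →* Multiplicative ℤ :=
  liftHom Γ (fun a => Multiplicative.ofAdd (if a = b then 1 else 0)) fun _ _ _ => Commute.all _ _

theorem expSum_gen_self (b : V) : expSum Γ b (gen Γ b) = Multiplicative.ofAdd 1 := by
  simp [expSum]

theorem expSum_gen_of_ne {a b : V} (h : a ≠ b) : expSum Γ b (gen Γ a) = 1 := by
  simp [expSum, h]

theorem expSum_of_mem_std {K : Set V} {b : V} (hb : b ∉ K) {z : Grp Γ} (hz : z ∈ std Γ K) :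
    expSum Γ b z = 1 := by
  refine std_induction hz (map_one _) fun z _ c hc => ?_
  rw [map_mul, expSum_gen_of_ne (by rintro rfl; exact hb hc), mul_one]

theorem gen_mem_std_iff {K : Set V} {a : V} : gen Γ a ∈ std Γ K ↔ a ∈ K := by
  refine ⟨fun h => ?_, gen_mem_std⟩
  by_contra ha
  have := expSum_of_mem_std ha h
  rw [expSum_gen_self] at this
  exact absurd this (by decide)

theorem label_eq_of_conj_eq {a b : V} {g h : Grp Γ}
    (e : g * gen Γ a * g⁻¹ = h * gen Γ b * h⁻¹) : a = b := by
  by_contra hab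
  have := congrArg (expSum Γ a) e
  simp only [map_mul, map_inv, mul_inv_cancel_comm, expSum_gen_self,
    expSum_gen_of_ne (Ne.symm hab)] at this
  exact absurd this (by decide)

theorem conj_gen_ne_one (g : Grp Γ) (a : V) : g * gen Γ a * g⁻¹ ≠ 1 := by
  intro e
  have := congrArg (expSum Γ a) e
  simp only [map_mul, map_inv, mul_inv_cancel_comm, expSum_gen_self, map_one] at this
  exact absurd this (by decide)

/-! ### Retractions onto standard subgroups and the Helly property -/

open Classical in
variable (Γ) in
/-- The retraction of `G(Γ)` onto `⟨K⟩` killing the generators outside `K`. -/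
noncomputable def retr (K : Set V) : Grp Γ →* Grp Γ :=
  liftHom Γ (fun a => if a ∈ K then gen Γ a else 1) fun a b hab => by
    split_ifs
    · exact commute_gen_of_adj hab
    · exact Commute.one_right _
    · exact Commute.one_left _
    · exact Commute.one_left _

theorem retr_gen_of_mem {K : Set V} {a : V} (h : a ∈ K) : retr Γ K (gen Γ a) = gen Γ a := by
  simp [retr, h]

theorem retr_gen_of_notMem {K : Set V} {a : V} (h : a ∉ K) : retr Γ K (gen Γ a) = 1 := by
  simp [retr, h]

theorem retr_of_mem {K : Set V} {z : Grp Γ} (hz : z ∈ std Γ K) : retr Γ K z = z := by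
  refine std_induction hz (map_one _) fun z _ c hc => ?_
  rw [map_mul, retr_gen_of_mem hc, mul_left_inj]

theorem retr_mem_inter (K : Set V) {L : Set V} {z : Grp Γ} (hz : z ∈ std Γ L) :
    retr Γ K z ∈ std Γ (L ∩ K) := by
  refine std_induction hz (by simp) fun z _ c hc => ?_
  rw [map_mul]
  by_cases h : c ∈ K
  · rw [retr_gen_of_mem h,
      Subgroup.mul_mem_cancel_right _ (gen_mem_std (show c ∈ L ∩ K from ⟨hc, h⟩))]
  · rw [retr_gen_of_notMem h, mul_one]

/-- If the cosets `h⟨K⟩`, `h⟨L⟩` and `g⟨M⟩` meet pairwise, they have a common point: retract a point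
of `h⟨K⟩ ∩ g⟨M⟩` into `h⟨L⟩`. -/
theorem helly_three {K L M : Set V} {h g x y : Grp Γ} (hx : h⁻¹ * x ∈ std Γ K)
    (hxg : g⁻¹ * x ∈ std Γ M) (hy : h⁻¹ * y ∈ std Γ L) (hyg : g⁻¹ * y ∈ std Γ M) :
    ∃ z, h⁻¹ * z ∈ std Γ (K ∩ L) ∧ g⁻¹ * z ∈ std Γ M := by
  refine ⟨h * retr Γ L (h⁻¹ * x), by simpa using retr_mem_inter L hx, ?_⟩
  have h1 : y⁻¹ * x ∈ std Γ M := by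
    simpa [mul_assoc] using (std Γ M).mul_mem ((std Γ M).inv_mem hyg) hxg
  have h2 := std_mono Set.inter_subset_left (retr_mem_inter L h1)
  have h3 : retr Γ L (h⁻¹ * x) = (h⁻¹ * y) * retr Γ L (y⁻¹ * x) := by
    conv_rhs => rw [← retr_of_mem hy]
    rw [← map_mul]
    congr 1
    group
  rw [h3]
  simpa [mul_assoc] using (std Γ M).mul_mem hyg h2

theorem helly_aux {ι : Type*} (g : ι → Grp Γ) (K : ι → Set V) (s : Finset ι)
    (hs : ∀ i ∈ s, ∀ j ∈ s, ∃ z, (g i)⁻¹ * z ∈ std Γ (K i) ∧ (g j)⁻¹ * z ∈ std Γ (K j)) :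
    ∀ (h : Grp Γ) (L : Set V),
      (∀ i ∈ s, ∃ z, h⁻¹ * z ∈ std Γ L ∧ (g i)⁻¹ * z ∈ std Γ (K i)) →
      ∃ z, h⁻¹ * z ∈ std Γ L ∧ ∀ i ∈ s, (g i)⁻¹ * z ∈ std Γ (K i) := by
  classical
  induction s using Finset.induction_on with
  | empty => exact fun h L _ => ⟨h, by simp, by simp⟩
  | insert i s hi ih =>
    intro h L hL
    obtain ⟨x, hxL, hxi⟩ := hL i (Finset.mem_insert_self i s)
    have coset : ∀ {k z : Grp Γ} {M : Set V}, k⁻¹ * x ∈ std Γ M →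
        (k⁻¹ * z ∈ std Γ M ↔ x⁻¹ * z ∈ std Γ M) := by
      intro k z M hk
      have : k⁻¹ * z = (k⁻¹ * x) * (x⁻¹ * z) := by group
      rw [this, Subgroup.mul_mem_cancel_left _ hk]
    obtain ⟨z, hz, hzs⟩ := ih
      (fun j hj k hk => hs j (Finset.mem_insert_of_mem hj) k (Finset.mem_insert_of_mem hk))
      x (L ∩ K i) (fun j hj => by
        obtain ⟨p, hp, hpj⟩ := hL j (Finset.mem_insert_of_mem hj)
        obtain ⟨q, hq, hqj⟩ := hs i (Finset.mem_insert_self i s) j (Finset.mem_insert_of_mem hj)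
        exact helly_three ((coset hxL).1 hp) hpj ((coset hxi).1 hq) hqj)
    refine ⟨z, (coset hxL).2 (std_mono Set.inter_subset_left hz), fun j hj => ?_⟩
    rcases Finset.mem_insert.1 hj with rfl | hj
    · exact (coset hxi).2 (std_mono Set.inter_subset_right hz)
    · exact hzs j hj

/-- Finitely many cosets of standard subgroups which meet pairwise have a common point. -/
theorem helly {ι : Type*} [Finite ι] (g : ι → Grp Γ) (K : ι → Set V)
    (hs : ∀ i j, ∃ z, (g i)⁻¹ * z ∈ std Γ (K i) ∧ (g j)⁻¹ * z ∈ std Γ (K j)) :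
    ∃ z, ∀ i, (g i)⁻¹ * z ∈ std Γ (K i) := by
  have := Fintype.ofFinite ι
  obtain ⟨z, -, hz⟩ := helly_aux g K Finset.univ (fun i _ j _ => hs i j) 1 Set.univ
    (fun i _ => ⟨g i, mem_std_univ _, by simp⟩)
  exact ⟨z, fun i => hz i (Finset.mem_univ i)⟩

/-! ### Potentials on the Cayley graph -/

/-- A function on the edges of `X(Γ)` whose sums along the two halves of the boundary of each square
agree is the increment of a function on the vertices. The group acts on the right of `G(Γ) × ℤ`,
with the generator `a` sending `(z, n)` to `(za, n + δ z a)`; the potential is read off from the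
orbit of `(1, 0)`. -/
theorem exists_potential (δ : Grp Γ → V → ℤ)
    (hδ : ∀ z a b, Γ.Adj a b → δ z a + δ (z * gen Γ a) b = δ z b + δ (z * gen Γ b) a) :
    ∃ ψ : Grp Γ → ℤ, ψ 1 = 0 ∧ ∀ z a, ψ (z * gen Γ a) = ψ z + δ z a := by
  let σ : V → (Equiv.Perm (Grp Γ × ℤ))ᵐᵒᵖ := fun a => MulOpposite.op
    { toFun := fun p => (p.1 * gen Γ a, p.2 + δ p.1 a)
      invFun := fun p => (p.1 * (gen Γ a)⁻¹, p.2 - δ (p.1 * (gen Γ a)⁻¹) a)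
      left_inv := fun p => by simp
      right_inv := fun p => by simp }
  let φ := liftHom Γ σ fun a b hab => by
    refine MulOpposite.unop_injective (Equiv.ext fun p => Prod.ext ?_ ?_)
    · change p.1 * gen Γ a * gen Γ b = p.1 * gen Γ b * gen Γ a
      rw [mul_assoc, (commute_gen_of_adj hab).eq, mul_assoc]
    · change p.2 + δ p.1 a + δ (p.1 * gen Γ a) b = p.2 + δ p.1 b + δ (p.1 * gen Γ b) a
      rw [add_assoc, add_assoc, hδ p.1 a b hab]
  have step : ∀ z a, (φ (z * gen Γ a)).unop (1, 0) =
      (((φ z).unop (1, 0)).1 * gen Γ a, ((φ z).unop (1, 0)).2 + δ ((φ z).unop (1, 0)).1 a) := by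
    intro z a
    rw [map_mul, MulOpposite.unop_mul, Equiv.Perm.mul_apply, show φ (gen Γ a) = σ a from
      liftHom_gen _ _ a]
    rfl
  have fst : ∀ z, ((φ z).unop (1, 0)).1 = z := by
    refine grp_induction (by simp) fun z c => ?_
    rw [step, mul_left_inj]
  refine ⟨fun z => ((φ z).unop (1, 0)).2, by simp, fun z a => ?_⟩
  simp only [step, fst]

/-! ### Counting the walls dual to a standard geodesic -/

theorem exists_wall (a : V) : ∃ ψ : Grp Γ → ℤ, ψ 1 = 0 ∧
    (∀ z c, c ≠ a → ψ (z * gen Γ c) = ψ z) ∧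
    (∀ z, z ∈ std Γ (closedStar Γ a) → ψ (z * gen Γ a) = ψ z + 1) ∧
    (∀ z, z ∉ std Γ (closedStar Γ a) → ψ (z * gen Γ a) = ψ z) := by
  classical
  obtain ⟨ψ, h1, h⟩ := exists_potential (Γ := Γ)
    (fun z c => if c = a ∧ z ∈ std Γ (closedStar Γ a) then 1 else 0) (by
      have key : ∀ z b, Γ.Adj a b →
          (z * gen Γ b ∈ std Γ (closedStar Γ a) ↔ z ∈ std Γ (closedStar Γ a)) := fun z b hb =>
        Subgroup.mul_mem_cancel_right _ (gen_mem_std (Or.inr hb))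
      intro z b c hbc
      by_cases hb : b = a
      · subst hb
        simp [hbc.ne', key z c hbc]
      · by_cases hc : c = a
        · subst hc
          simp [hb, key z b hbc.symm]
        · simp [hb, hc])
  exact ⟨ψ, h1, fun z c hc => by simp [h, hc], fun z hz => by simp [h, hz],
    fun z hz => by simp [h, hz]⟩

/-- The signed number of hyperplanes dual to the geodesic `⟨a⟩` that separate `1` from `z`, that is,
the coordinate of the projection of `z` to this geodesic. It changes exactly along the edges
labelled `a` issuing from the points of `⟨St(a)⟩`. -/
noncomputable def wall (a : V) : Grp Γ → ℤ := (exists_wall a).choose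

theorem wall_one (a : V) : wall a (1 : Grp Γ) = 0 := (exists_wall a).choose_spec.1

theorem wall_mul_gen_of_ne {a c : V} (z : Grp Γ) (h : c ≠ a) : wall a (z * gen Γ c) = wall a z :=
  (exists_wall a).choose_spec.2.1 z c h

theorem wall_mul_gen_of_mem {a : V} {z : Grp Γ} (h : z ∈ std Γ (closedStar Γ a)) :
    wall a (z * gen Γ a) = wall a z + 1 :=
  (exists_wall a).choose_spec.2.2.1 z h

theorem wall_mul_gen_of_notMem {a : V} {z : Grp Γ} (h : z ∉ std Γ (closedStar Γ a)) :
    wall a (z * gen Γ a) = wall a z :=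
  (exists_wall a).choose_spec.2.2.2 z h

theorem self_mem_closedStar (a : V) : a ∈ closedStar Γ a := Or.inl rfl

theorem wall_mul_of_mem {a : V} {k : Grp Γ} (hk : k ∈ std Γ (closedStar Γ a)) (z : Grp Γ) :
    wall a (k * z) = wall a k + wall a z := by
  revert z
  refine grp_induction (by simp [wall_one]) fun z c => ?_
  rw [← mul_assoc]
  by_cases hc : c = a
  · subst hc
    by_cases hz : z ∈ std Γ (closedStar Γ c)
    · rw [wall_mul_gen_of_mem hz, wall_mul_gen_of_mem (Subgroup.mul_mem _ hk hz)]
      omega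
    · rw [wall_mul_gen_of_notMem hz,
        wall_mul_gen_of_notMem ((Subgroup.mul_mem_cancel_left _ hk).not.2 hz)]
  · rw [wall_mul_gen_of_ne _ hc, wall_mul_gen_of_ne _ hc]

theorem wall_gen_self (a : V) : wall a (gen Γ a) = 1 := by
  simpa [wall_one] using wall_mul_gen_of_mem (Subgroup.one_mem (std Γ (closedStar Γ a)))

theorem wall_gen_mul (a : V) (z : Grp Γ) : wall a (gen Γ a * z) = wall a z + 1 := by
  rw [wall_mul_of_mem (gen_mem_std (self_mem_closedStar a)), wall_gen_self, add_comm]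

theorem commute_of_mem_closedStar {a c : V} (h : c ∈ closedStar Γ a) :
    Commute (gen Γ c) (gen Γ a) := by
  rcases h with rfl | h
  · exact Commute.refl _
  · exact (commute_gen_of_adj h).symm

/-- The centralizer of the generator `a` is `⟨St(a)⟩`: if `z` commutes with `a`, then the edge from
`z` to `za = az` changes the projection to `⟨a⟩`. -/
theorem commute_gen_iff {a : V} {z : Grp Γ} :
    Commute z (gen Γ a) ↔ z ∈ std Γ (closedStar Γ a) := by
  constructor
  · intro h
    by_contra hz
    have h1 := wall_gen_mul a z
    rw [← h.eq, wall_mul_gen_of_notMem hz] at h1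
    omega
  · intro hz
    refine std_induction hz (Commute.one_left _) fun z _ c hc => ?_
    have := commute_of_mem_closedStar hc
    exact ⟨fun h => h.mul_left this, fun h => by simpa using h.mul_left this.inv_left⟩

theorem commute_gen_gen_iff {a b : V} : Commute (gen Γ b) (gen Γ a) ↔ b ∈ closedStar Γ a := by
  rw [commute_gen_iff, gen_mem_std_iff]

theorem commute_conj_conj {G : Type*} [Group G] (g x y : G) :
    Commute (g * x * g⁻¹) (g * y * g⁻¹) ↔ Commute x y :=
  Commute.conj_iff g

theorem commute_conj_iff {G : Type*} [Group G] (g x y : G) :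
    Commute x (g * y * g⁻¹) ↔ Commute (g⁻¹ * x * g) y := by
  rw [← commute_conj_conj g (g⁻¹ * x * g) y]
  simp [mul_assoc]

/-- If the projection to `⟨a⟩` is not constant on the coset `h⟨S⟩`, the coset contains an edge
dual to this geodesic. -/
theorem exists_crossing {a : V} {S : Set V} {h w : Grp Γ} (hw : w ∈ std Γ S)
    (hne : wall a (h * w) ≠ wall a h) :
    a ∈ S ∧ ∃ k ∈ std Γ S, h * k ∈ std Γ (closedStar Γ a) := by
  by_contra hcon
  refine hne ?_
  clear hne
  refine std_induction hw (by simp) fun z hz c hc => ?_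
  rw [← mul_assoc]
  by_cases hca : c = a
  · subst hca
    rw [wall_mul_gen_of_notMem fun hmem => hcon ⟨hc, z, hz, hmem⟩]
  · rw [wall_mul_gen_of_ne _ hca]

theorem conj_eq_conj {a : V} {g h : Grp Γ} (hgh : g⁻¹ * h ∈ std Γ (closedStar Γ a)) :
    g * gen Γ a * g⁻¹ = h * gen Γ a * h⁻¹ := by
  have := (commute_gen_iff.2 hgh).eq
  rw [eq_mul_inv_iff_mul_eq]
  calc g * gen Γ a * g⁻¹ * h = g * (gen Γ a * (g⁻¹ * h)) := by group
    _ = h * gen Γ a := by rw [← this]; group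

theorem conj_eq_conj_iff {a b : V} {g h : Grp Γ} :
    g * gen Γ a * g⁻¹ = h * gen Γ b * h⁻¹ ↔ a = b ∧ g⁻¹ * h ∈ std Γ (closedStar Γ a) := by
  constructor
  · intro e
    obtain rfl := label_eq_of_conj_eq e
    refine ⟨rfl, commute_gen_iff.1 ?_⟩
    rw [eq_mul_inv_iff_mul_eq] at e
    change g⁻¹ * h * gen Γ a = gen Γ a * (g⁻¹ * h)
    rw [mul_assoc, ← e]
    group
  · rintro ⟨rfl, h⟩
    exact conj_eq_conj h

/-- The projection to the geodesic `g⟨a⟩` is constant on the parallel set `h⟨St(b)⟩` of a geodesic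
whose vertex is not in the star of the vertex of `g⟨a⟩`. -/
theorem wall_eq_of_not_commute {a b : V} {g h k : Grp Γ}
    (hn : ¬ Commute (g * gen Γ a * g⁻¹) (h * gen Γ b * h⁻¹))
    (hk : h⁻¹ * k ∈ std Γ (closedStar Γ b)) : wall a (g⁻¹ * k) = wall a (g⁻¹ * h) := by
  by_contra hne
  have e : g⁻¹ * k = g⁻¹ * h * (h⁻¹ * k) := by group
  rw [e] at hne
  obtain ⟨hab, m, hm, hmem⟩ := exists_crossing hk hne
  refine hn ?_
  have h1 : h * gen Γ b * h⁻¹ = (h * m) * gen Γ b * (h * m)⁻¹ := conj_eq_conj (by simpa using hm)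
  have h2 : g * gen Γ a * g⁻¹ = (h * m) * gen Γ a * (h * m)⁻¹ :=
    conj_eq_conj (by simpa [mul_assoc] using hmem)
  rw [h1, h2, commute_conj_conj]
  exact commute_of_mem_closedStar hab

/-- The parallel sets of two geodesics whose vertices commute have a common point. -/
theorem exists_common_of_commute {a b : V} {g h : Grp Γ}
    (hc : Commute (g * gen Γ a * g⁻¹) (h * gen Γ b * h⁻¹)) :
    ∃ z, g⁻¹ * z ∈ std Γ (closedStar Γ a) ∧ h⁻¹ * z ∈ std Γ (closedStar Γ b) := by
  rw [commute_conj_iff, commute_gen_iff] at hc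
  have hne : wall a (g⁻¹ * h * (h⁻¹ * (g * gen Γ a * g⁻¹) * h)) ≠ wall a (g⁻¹ * h) := by
    have e : g⁻¹ * h * (h⁻¹ * (g * gen Γ a * g⁻¹) * h) = gen Γ a * (g⁻¹ * h) := by group
    rw [e, wall_gen_mul]
    omega
  obtain ⟨-, k, hk, hmem⟩ := exists_crossing hc hne
  exact ⟨h * k, by simpa [mul_assoc] using hmem, by simpa using hk⟩

end Basics

section Words

variable {V : Type u} {Γ : SimpleGraph V}

/-! ### Words and shortest words -/

variable (Γ) in
/-- The generator `a` for the letter `(a, true)` and its inverse for `(a, false)`. -/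
def letter (p : V × Bool) : Grp Γ := if p.2 then gen Γ p.1 else (gen Γ p.1)⁻¹

variable (Γ) in
/-- The element of `G(Γ)` spelled by a word. -/
def word (L : List (V × Bool)) : Grp Γ := (L.map (letter Γ)).prod

@[simp] theorem word_nil : word Γ [] = 1 := rfl

@[simp] theorem word_cons (p : V × Bool) (L : List (V × Bool)) :
    word Γ (p :: L) = letter Γ p * word Γ L := by simp [word]

@[simp] theorem word_append (L M : List (V × Bool)) : word Γ (L ++ M) = word Γ L * word Γ M := by
  simp [word]

theorem letter_not (a : V) (ε : Bool) : letter Γ (a, !ε) = (letter Γ (a, ε))⁻¹ := by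
  cases ε <;> simp [letter]

theorem exists_word (z : Grp Γ) : ∃ L, word Γ L = z := by
  revert z
  refine grp_induction (P := fun z => ∃ L, word Γ L = z) ⟨[], rfl⟩ fun z c => ⟨?_, ?_⟩
  · rintro ⟨L, rfl⟩
    exact ⟨L ++ [(c, true)], by simp [letter]⟩
  · rintro ⟨L, hL⟩
    exact ⟨L ++ [(c, false)], by simp [letter, hL]⟩

theorem letter_mem_std {K : Set V} {p : V × Bool} (h : p.1 ∈ K) : letter Γ p ∈ std Γ K := by
  unfold letter
  split_ifs
  · exact gen_mem_std h
  · exact inv_mem (gen_mem_std h)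

theorem commute_letter_iff {p : V × Bool} {z : Grp Γ} :
    Commute z (letter Γ p) ↔ Commute z (gen Γ p.1) := by
  unfold letter
  split_ifs
  · rfl
  · exact Commute.inv_right_iff

/-- The exponent of a letter. -/
def sgn (ε : Bool) : ℤ := if ε then 1 else -1

theorem wall_mul_letter (a : V) (z : Grp Γ) (p : V × Bool) :
    wall a (z * letter Γ p) = wall a z ∨
      p.1 = a ∧ z ∈ std Γ (closedStar Γ a) ∧ wall a (z * letter Γ p) = wall a z + sgn p.2 := by
  obtain ⟨c, ε⟩ := p
  by_cases hc : c = a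
  swap
  · left
    cases ε
    · simpa [letter] using (wall_mul_gen_of_ne (z * (gen Γ c)⁻¹) hc).symm
    · exact wall_mul_gen_of_ne z hc
  subst hc
  have hself := gen_mem_std (Γ := Γ) (self_mem_closedStar (Γ := Γ) c)
  by_cases hz : z ∈ std Γ (closedStar Γ c)
  · refine Or.inr ⟨rfl, hz, ?_⟩
    cases ε
    · have := wall_mul_gen_of_mem (mul_mem hz (inv_mem hself))
      rw [inv_mul_cancel_right] at this
      simp only [letter, sgn, Bool.false_eq_true, if_false]
      omega
    · exact wall_mul_gen_of_mem hz
  · left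
    cases ε
    · have := wall_mul_gen_of_notMem
        ((Subgroup.mul_mem_cancel_right _ (inv_mem hself)).not.2 hz)
      rw [inv_mul_cancel_right] at this
      exact this.symm
    · exact wall_mul_gen_of_notMem hz

/-- A path along which the projection to `⟨a⟩` moves in the direction `ε` in total contains an edge
dual to this geodesic that is traversed in the direction `ε`. -/
theorem exists_split {a : V} {ε : Bool} (L : List (V × Bool)) (u : Grp Γ)
    (h : sgn ε * wall a u < sgn ε * wall a (u * word Γ L)) :
    ∃ L₁ L₂, L = L₁ ++ (a, ε) :: L₂ ∧ u * word Γ L₁ ∈ std Γ (closedStar Γ a) := by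
  induction L generalizing u with
  | nil => simp at h
  | cons p L ih =>
    rw [word_cons, ← mul_assoc] at h
    have next : sgn ε * wall a (u * letter Γ p) ≤ sgn ε * wall a u →
        ∃ L₁ L₂, p :: L = L₁ ++ (a, ε) :: L₂ ∧ u * word Γ L₁ ∈ std Γ (closedStar Γ a) := by
      intro hle
      obtain ⟨L₁, L₂, rfl, hm⟩ := ih _ (hle.trans_lt h)
      exact ⟨p :: L₁, L₂, rfl, by simpa [mul_assoc] using hm⟩
    rcases wall_mul_letter a u p with e | ⟨hp, hu, e⟩
    · exact next (by rw [e])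
    · by_cases hε : p.2 = ε
      · exact ⟨[], L, by rw [← hp, ← hε]; rfl, by simpa using hu⟩
      · refine next ?_
        rw [e]
        revert hε
        cases p.2 <;> cases ε <;> simp [sgn]

/-- `L` is a shortest word representing an element of its left coset of `⟨S⟩`. -/
def IsShortest (Γ : SimpleGraph V) (S : Set V) (L : List (V × Bool)) : Prop :=
  ∀ M, (word Γ L)⁻¹ * word Γ M ∈ std Γ S → L.length ≤ M.length

theorem exists_isShortest (S : Set V) (h : Grp Γ) :
    ∃ L, h⁻¹ * word Γ L ∈ std Γ S ∧ IsShortest Γ S L := by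
  obtain ⟨L₀, hL₀⟩ := exists_word h
  have hne : {L : List (V × Bool) | h⁻¹ * word Γ L ∈ std Γ S}.Nonempty := ⟨L₀, by simp [hL₀]⟩
  refine ⟨Function.argminOn List.length _ hne, Function.argminOn_mem List.length _ hne,
    fun M hM => ?_⟩
  refine Function.argminOn_le List.length _ (show h⁻¹ * word Γ M ∈ std Γ S from ?_)
  have := mul_mem (Function.argminOn_mem List.length _ hne) hM
  simpa [mul_assoc] using this

theorem IsShortest.tail {S : Set V} {p : V × Bool} {l : List (V × Bool)}
    (h : IsShortest Γ S (p :: l)) : IsShortest Γ S l := by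
  intro M hM
  have := h (p :: M) (by simpa [mul_assoc] using hM)
  simpa using this

/-- The hyperplane dual to the first edge of a shortest path separates its endpoints: if the path
crossed it again, the two crossings could be cancelled. -/
theorem IsShortest.wall_ne_zero {S : Set V} {c : V} {ε : Bool} {l : List (V × Bool)}
    (h : IsShortest Γ S ((c, ε) :: l)) : wall c (word Γ ((c, ε) :: l)) ≠ 0 := by
  intro h0
  have h1 : wall c (letter Γ (c, ε)) = sgn ε := by
    rcases wall_mul_letter c (1 : Grp Γ) (c, ε) with e | ⟨-, -, e⟩
    · exfalso
      rw [one_mul, wall_one] at e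
      cases ε
      · have := wall_gen_mul c ((gen Γ c)⁻¹)
        simp only [letter, Bool.false_eq_true, if_false] at e
        rw [mul_inv_cancel, wall_one] at this
        omega
      · have := wall_gen_self (Γ := Γ) c
        simp only [letter, if_true] at e
        omega
    · simpa [wall_one] using e
  obtain ⟨L₁, L₂, rfl, hm⟩ := exists_split (a := c) (ε := !ε) l (letter Γ (c, ε)) (by
    rw [word_cons] at h0
    rw [h0, h1]
    cases ε <;> simp [sgn])
  rw [Subgroup.mul_mem_cancel_left _ (letter_mem_std (self_mem_closedStar c))] at hm
  have hcomm : Commute (word Γ L₁) (letter Γ (c, ε)) :=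
    commute_letter_iff.2 (commute_gen_iff.2 hm)
  have := h (L₁ ++ L₂) (by
    have e : word Γ ((c, ε) :: (L₁ ++ (c, !ε) :: L₂)) = word Γ (L₁ ++ L₂) := by
      simp only [word_cons, word_append, letter_not]
      rw [← mul_assoc, ← hcomm.eq]
      group
    rw [e, inv_mul_cancel]
    exact one_mem _)
  simp only [List.length_cons, List.length_append] at this
  omega

theorem IsShortest.not_commute {a c : V} {ε : Bool} {l : List (V × Bool)}
    (h : IsShortest Γ (closedStar Γ a) ((c, ε) :: l)) :
    ¬ Commute (gen Γ c) (word Γ ((c, ε) :: l) * gen Γ a * (word Γ ((c, ε) :: l))⁻¹) := by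
  intro hc
  have h1 := (commute_letter_iff (p := (c, ε))).2 hc.symm
  rw [← Commute.inv_right_iff] at h1
  have h2 := (commute_conj_iff _ _ _).1 h1.symm
  rw [commute_gen_iff] at h2
  have := h l (by simpa [mul_assoc] using h2)
  simp at this

theorem expSum_word_le (b : V) (L : List (V × Bool)) :
    |Multiplicative.toAdd (expSum Γ b (word Γ L))| ≤ L.length := by
  induction L with
  | nil => simp
  | cons p L ih =>
    have h1 : |Multiplicative.toAdd (expSum Γ b (letter Γ p))| ≤ 1 := by
      obtain ⟨c, ε⟩ := p
      by_cases hc : c = b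
      · subst hc
        cases ε <;> simp [letter, expSum_gen_self]
      · cases ε <;> simp [letter, expSum_gen_of_ne hc]
    rw [word_cons, map_mul, toAdd_mul]
    refine (abs_add_le _ _).trans ?_
    push_cast [List.length_cons]
    omega

/-- A generator `b` commuting with the conjugate of `a` by a shortest word commutes with the first
letter `c` of this word. Otherwise a translate of the word by a large power of `b` would, like the
word itself, cross a hyperplane dual to `⟨c⟩`, which the exponents of `b` do not allow. -/
theorem IsShortest.mem_closedStar {a b c : V} {ε : Bool} {l : List (V × Bool)}
    (h : IsShortest Γ (closedStar Γ a) ((c, ε) :: l))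
    (hb : Commute (gen Γ b) (word Γ ((c, ε) :: l) * gen Γ a * (word Γ ((c, ε) :: l))⁻¹)) :
    b ∈ closedStar Γ c := by
  by_contra hbc
  have h0 := h.wall_ne_zero
  have hn := h.not_commute
  generalize (c, ε) :: l = L at *
  have hpow : ∀ n : ℕ, wall c (gen Γ b ^ n) = 0 := by
    intro n
    induction n with
    | zero => simp [wall_one]
    | succ n ih =>
      rw [pow_succ, wall_mul_gen_of_ne _ (by rintro rfl; exact hbc (self_mem_closedStar _)), ih]
  have hw : wall c (gen Γ b ^ (L.length + 1) * word Γ L) = wall c (word Γ L) := by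
    have := wall_eq_of_not_commute (a := c) (g := 1) (h := word Γ L) (b := a)
      (k := gen Γ b ^ (L.length + 1) * word Γ L) (by simpa using hn) (by
        rw [← commute_gen_iff, ← mul_assoc, ← commute_conj_iff]
        exact hb.pow_left _)
    simpa using this
  have hcross : ∃ L₁ L₂, L = L₁ ++ L₂ ∧
      gen Γ b ^ (L.length + 1) * word Γ L₁ ∈ std Γ (closedStar Γ c) := by
    rcases lt_or_gt_of_ne h0 with hlt | hlt
    · obtain ⟨L₁, L₂, e, hm⟩ := exists_split (a := c) (ε := false) L (gen Γ b ^ (L.length + 1)) (by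
        rw [hw, hpow]; simpa [sgn] using hlt)
      exact ⟨L₁, _, e, hm⟩
    · obtain ⟨L₁, L₂, e, hm⟩ := exists_split (a := c) (ε := true) L (gen Γ b ^ (L.length + 1)) (by
        rw [hw, hpow]; simpa [sgn] using hlt)
      exact ⟨L₁, _, e, hm⟩
  obtain ⟨L₁, L₂, e, hm⟩ := hcross
  have h1 := congrArg Multiplicative.toAdd (expSum_of_mem_std hbc hm)
  rw [map_mul, map_pow, expSum_gen_self, toAdd_mul, toAdd_pow, toAdd_ofAdd, toAdd_one] at h1
  have h2 := expSum_word_le (Γ := Γ) b L₁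
  have h3 : L.length = L₁.length + L₂.length := by rw [e, List.length_append]
  rw [abs_le] at h2
  rw [h3] at h1
  simp at h1
  omega

/-- Two disjoint parallel sets are separated by a hyperplane crossing neither of them, namely the
one dual to the first edge of a shortest path between them. -/
theorem exists_wall_separating {a b : V} {g h : Grp Γ}
    (hdis : ¬ ∃ z, g⁻¹ * z ∈ std Γ (closedStar Γ a) ∧ h⁻¹ * z ∈ std Γ (closedStar Γ b)) :
    ∃ (k : Grp Γ) (c : V), ¬ Commute (k * gen Γ c * k⁻¹) (g * gen Γ a * g⁻¹) ∧
      ¬ Commute (k * gen Γ c * k⁻¹) (h * gen Γ b * h⁻¹) ∧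
      wall c (k⁻¹ * g) ≠ wall c (k⁻¹ * h) := by
  let T : Set (List (V × Bool)) := {L | ∃ m, g⁻¹ * m ∈ std Γ (closedStar Γ a) ∧
    h⁻¹ * (m * word Γ L) ∈ std Γ (closedStar Γ b)}
  have hne : T.Nonempty := by
    obtain ⟨L, hL⟩ := exists_word (g⁻¹ * h)
    exact ⟨L, g, by simp, by simp [hL]⟩
  obtain ⟨m, hm, hL⟩ := Function.argminOn_mem List.length T hne
  have hmin : ∀ M ∈ T, (Function.argminOn List.length T hne).length ≤ M.length := fun M hM =>
    Function.argminOn_le List.length T hM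
  generalize Function.argminOn List.length T hne = L at hL hmin
  obtain _ | ⟨⟨c, ε⟩, l⟩ := L
  · exact absurd ⟨m, hm, by simpa using hL⟩ hdis
  have hshort : IsShortest Γ (closedStar Γ b) ((c, ε) :: l) := fun M hM =>
    hmin M ⟨m, hm, by simpa [mul_assoc] using mul_mem hL hM⟩
  have hca : c ∉ closedStar Γ a := by
    intro hca
    have := hmin l ⟨m * letter Γ (c, ε), by
      rw [← mul_assoc]
      exact mul_mem hm (letter_mem_std hca), by simpa [mul_assoc] using hL⟩
    simp at this
  have n1 : ¬ Commute (m * gen Γ c * m⁻¹) (g * gen Γ a * g⁻¹) := by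
    rw [conj_eq_conj hm, commute_conj_conj, commute_gen_gen_iff]
    exact hca
  have n2 : ¬ Commute (m * gen Γ c * m⁻¹) (h * gen Γ b * h⁻¹) := by
    have e : m * word Γ ((c, ε) :: l) * gen Γ b * (m * word Γ ((c, ε) :: l))⁻¹ =
      m * (word Γ ((c, ε) :: l) * gen Γ b * (word Γ ((c, ε) :: l))⁻¹) * m⁻¹ := by group
    rw [conj_eq_conj hL, e, commute_conj_conj]
    exact hshort.not_commute
  refine ⟨m, c, n1, n2, ?_⟩
  rw [← wall_eq_of_not_commute n1 hm, ← wall_eq_of_not_commute n2 hL, inv_mul_cancel, wall_one,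
    inv_mul_cancel_left]
  exact hshort.wall_ne_zero.symm

end Words

/-! ### Paths and separation in graphs -/

section Separation

variable {V : Type u}

/-- `Joined A U x y`: there is a path in `A` from `x` to `y` inside `U` (or `x = y`). -/
def Joined (A : SimpleGraph V) (U : Set V) : V → V → Prop :=
  Relation.ReflTransGen fun x y => A.Adj x y ∧ x ∈ U ∧ y ∈ U

theorem Joined.symm {A : SimpleGraph V} {U : Set V} {x y : V} (h : Joined A U x y) :
    Joined A U y x :=
  have : Std.Symm fun x y => A.Adj x y ∧ x ∈ U ∧ y ∈ U :=
    ⟨fun _ _ h => ⟨h.1.symm, h.2.2, h.2.1⟩⟩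
  Relation.ReflTransGen.stdSymm.symm _ _ h

theorem Joined.mono {A : SimpleGraph V} {U W : Set V} (hUW : U ⊆ W) {x y : V}
    (h : Joined A U x y) : Joined A W x y :=
  Relation.ReflTransGen.mono (fun _ _ h => ⟨h.1, hUW h.2.1, hUW h.2.2⟩) _ _ h

theorem preconnected_induce_iff (A : SimpleGraph V) (U : Set V) :
    (A.induce U).Preconnected ↔ ∀ x ∈ U, ∀ y ∈ U, Joined A U x y := by
  constructor
  · intro h x hx y hy
    have := (SimpleGraph.reachable_iff_reflTransGen _ _).1 (h ⟨x, hx⟩ ⟨y, hy⟩)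
    exact Relation.ReflTransGen.lift Subtype.val (fun p q hpq => ⟨hpq, p.2, q.2⟩) _ _ this
  · rintro h ⟨x, hx⟩ ⟨y, hy⟩
    have key : ∀ z, Joined A U x z → ∀ hz : z ∈ U,
        (A.induce U).Reachable ⟨x, hx⟩ ⟨z, hz⟩ := by
      intro z hxz
      induction hxz with
      | refl => exact fun _ => SimpleGraph.Reachable.refl _
      | tail _ hbc ih =>
        exact fun hz => (ih hbc.2.1).trans (SimpleGraph.Adj.reachable (by exact hbc.1))
    exact key y (h x hx y hy) hy

theorem not_separates_iff (A : SimpleGraph V) (S Y : Set V) :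
    ¬ Separates A S Y ↔ ∀ x ∈ Y \ S, ∀ y ∈ Y \ S, Joined A (Y \ S) x y := by
  rw [Separates, not_not, preconnected_induce_iff]

theorem not_separates_empty_univ_iff (A : SimpleGraph V) :
    ¬ Separates A ∅ Set.univ ↔ A.Preconnected := by
  rw [Separates, not_not, Set.sdiff_empty]
  exact (SimpleGraph.induceUnivIso A).preconnected_iff

/-- In a graph of weak type II the common link of any two vertices that are neither equal nor
adjacent does not separate: it is empty if their distance is not two. -/
theorem IsWeakTypeII.not_separates {A : SimpleGraph V} (h : IsWeakTypeII A) {e c : V}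
    (hec : e ≠ c) (hadj : ¬ A.Adj e c) :
    ¬ Separates A (A.neighborSet e ∩ A.neighborSet c) Set.univ := by
  rcases Set.eq_empty_or_nonempty (A.neighborSet e ∩ A.neighborSet c) with h0 | ⟨d, hd1, hd2⟩
  · rw [h0, not_separates_empty_univ_iff]
    exact h.1
  · refine h.2 e c ?_
    have h1 : A.dist e c ≤ 2 :=
      SimpleGraph.dist_le (.cons hd1 (.cons (SimpleGraph.Adj.symm hd2) .nil))
    have h2 : A.dist e c ≠ 0 := fun h0 => hec ((h.1 e c).dist_eq_zero_iff.1 h0)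
    have h3 : A.dist e c ≠ 1 := fun h0 => hadj (SimpleGraph.dist_eq_one_iff_adj.1 h0)
    omega

end Separation

/-! ### Weak type I in terms of conjugates of generators -/

section WeakType

variable {V : Type u} {Γ : SimpleGraph V}

variable (Γ) in
/-- The set of vertices of `Γ` whose generators commute with `u`. -/
def centralizing (u : Grp Γ) : Set V := {b | Commute (gen Γ b) u}

theorem centralizing_gen (a : V) : centralizing Γ (gen Γ a) = closedStar Γ a :=
  Set.ext fun _ => commute_gen_gen_iff

theorem mem_closedStar_comm {a b : V} : a ∈ closedStar Γ b ↔ b ∈ closedStar Γ a :=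
  ⟨Or.imp Eq.symm SimpleGraph.Adj.symm, Or.imp Eq.symm SimpleGraph.Adj.symm⟩

theorem commute_word {c : V} {L : List (V × Bool)} (h : ∀ p ∈ L, c ∈ closedStar Γ p.1) :
    Commute (gen Γ c) (word Γ L) := by
  induction L with
  | nil => exact Commute.one_right _
  | cons p L ih =>
    rw [word_cons]
    refine Commute.mul_right (commute_letter_iff.2 (commute_of_mem_closedStar ?_))
      (ih fun q hq => h q (List.mem_cons_of_mem _ hq))
    exact h p List.mem_cons_self

/-- Removing one letter from a shortest conjugating word at a time: with `c` the first letter, the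
vertices commuting with the conjugate are those in `St(c)` commuting with the shorter conjugate, and
some later letter `e` (or `a` itself) does not commute with `c`, so that they all lie in
`lk(e) ∩ lk(c)`. The complement is the union of two connected graphs containing `c`. -/
theorem not_separates_of_isShortest (hΓ : IsWeakTypeI Γ) (a : V) (L : List (V × Bool))
    (hL : IsShortest Γ (closedStar Γ a) L) :
    (∀ b ∈ centralizing Γ (word Γ L * gen Γ a * (word Γ L)⁻¹),
      b ∈ closedStar Γ a ∧ ∀ p ∈ L, b ∈ closedStar Γ p.1) ∧
    ¬ Separates Γ (centralizing Γ (word Γ L * gen Γ a * (word Γ L)⁻¹)) Set.univ := by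
  induction L with
  | nil =>
    simp only [word_nil, one_mul, inv_one, mul_one, centralizing_gen]
    exact ⟨fun b hb => ⟨hb, by simp⟩, hΓ.2 a⟩
  | cons p l ih =>
    obtain ⟨c, ε⟩ := p
    obtain ⟨ih1, ih2⟩ := ih hL.tail
    have hnc := hL.not_commute
    have hstar := fun b => hL.mem_closedStar (b := b)
    set v := word Γ l * gen Γ a * (word Γ l)⁻¹ with hv
    have hv' : word Γ ((c, ε) :: l) * gen Γ a * (word Γ ((c, ε) :: l))⁻¹ =
        letter Γ (c, ε) * v * (letter Γ (c, ε))⁻¹ := by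
      rw [hv, word_cons]
      group
    rw [hv'] at hnc hstar ⊢
    set v' := letter Γ (c, ε) * v * (letter Γ (c, ε))⁻¹ with hvv
    -- a vertex of `St(c)` commutes with `v'` if and only if it commutes with `v`
    have hred : ∀ b ∈ closedStar Γ c, (Commute (gen Γ b) v' ↔ Commute (gen Γ b) v) := by
      intro b hb
      have := (commute_letter_iff (p := (c, ε))).2 (commute_of_mem_closedStar hb)
      rw [hvv, commute_conj_iff, mul_assoc, this.eq, inv_mul_cancel_left]
    have hall : ∀ b ∈ centralizing Γ v',
        b ∈ closedStar Γ a ∧ ∀ p ∈ (c, ε) :: l, b ∈ closedStar Γ p.1 := by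
      intro b hb
      have hbc := hstar b hb
      obtain ⟨h1, h2⟩ := ih1 b ((hred b hbc).1 hb)
      exact ⟨h1, List.forall_mem_cons.2 ⟨hbc, h2⟩⟩
    refine ⟨hall, ?_⟩
    have hsub : centralizing Γ v' ⊆ centralizing Γ v := fun b hb => (hred b (hstar b hb)).1 hb
    have hcv : c ∉ centralizing Γ v := fun hc => hnc ((hred c (self_mem_closedStar c)).2 hc)
    have hex : ∃ e, (∀ b ∈ centralizing Γ v', b ∈ closedStar Γ e) ∧ c ∉ closedStar Γ e := by
      by_contra hcon
      push Not at hcon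
      have h1 : Commute (gen Γ c) (gen Γ a) :=
        commute_of_mem_closedStar (hcon a fun b hb => (hall b hb).1)
      have h2 : Commute (gen Γ c) (word Γ l) := commute_word fun p hp =>
        hcon p.1 fun b hb => (hall b hb).2 p (List.mem_cons_of_mem _ hp)
      exact hcv ((h2.mul_right h1).mul_right h2.inv_right)
    obtain ⟨e, he, hce⟩ := hex
    have hlink : centralizing Γ v' ⊆ Γ.neighborSet e ∩ Γ.neighborSet c := by
      intro b hb
      constructor
      · refine (he b hb).resolve_left ?_
        rintro rfl
        exact hce (mem_closedStar_comm.1 (hstar b hb))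
      · refine (hstar b hb).resolve_left ?_
        rintro rfl
        exact hnc hb
    have hj2 := (not_separates_iff _ _ _).1 (hΓ.1.not_separates (e := e) (c := c)
      (fun h => hce (Or.inl h.symm)) fun h => hce (Or.inr h))
    rw [not_separates_iff] at ih2 ⊢
    have toc : ∀ x ∈ Set.univ \ centralizing Γ v', Joined Γ (Set.univ \ centralizing Γ v') x c := by
      rintro x ⟨-, hx⟩
      by_cases hxv : x ∈ centralizing Γ v
      · have hxc : x ∉ Γ.neighborSet c := fun h => hx ((hred x (Or.inr h)).2 hxv)
        exact (hj2 x ⟨trivial, fun h => hxc h.2⟩ c ⟨trivial, fun h => Γ.irrefl h.2⟩).mono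
          (Set.sdiff_subset_sdiff_right hlink)
      · exact (ih2 x ⟨trivial, hxv⟩ c ⟨trivial, hcv⟩).mono (Set.sdiff_subset_sdiff_right hsub)
    exact fun x hx y hy => (toc x hx).trans (toc y hy).symm

theorem centralizing_conj_gen {a c : V} (hac : a ≠ c) (hadj : ¬ Γ.Adj a c) :
    centralizing Γ (gen Γ c * gen Γ a * (gen Γ c)⁻¹) = Γ.neighborSet a ∩ Γ.neighborSet c := by
  have hca : c ∉ closedStar Γ a := by
    rintro (h | h)
    exacts [hac h.symm, hadj h]
  ext b
  constructor
  · intro h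
    have h1 := commute_gen_iff.1 ((commute_conj_iff _ _ _).1 h)
    have h2 := retr_of_mem h1
    rw [map_mul, map_mul, map_inv, retr_gen_of_notMem hca, inv_one, one_mul, mul_one] at h2
    by_cases hb : b ∈ closedStar Γ a
    · rw [retr_gen_of_mem hb, mul_assoc, eq_inv_mul_iff_mul_eq] at h2
      have h3 : b ∈ closedStar Γ c := commute_gen_gen_iff.1 h2.symm
      refine ⟨hb.resolve_left ?_, h3.resolve_left ?_⟩
      · rintro rfl
        exact hca (mem_closedStar_comm.1 h3)
      · rintro rfl
        exact hca hb
    · rw [retr_gen_of_notMem hb] at h2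
      exact absurd h2.symm (by simpa using conj_gen_ne_one (gen Γ c)⁻¹ b)
  · rintro ⟨h1, h2⟩
    have e1 := commute_of_mem_closedStar (Γ := Γ) (Or.inr h1 : b ∈ closedStar Γ a)
    have e2 := commute_of_mem_closedStar (Γ := Γ) (Or.inr h2 : b ∈ closedStar Γ c)
    exact (e2.mul_right e1).mul_right e2.inv_right

/-- Weak type I in terms of the vertices commuting with a conjugate of a generator. -/
theorem isWeakTypeI_iff : IsWeakTypeI Γ ↔
    ∀ (g : Grp Γ) (a : V), ¬ Separates Γ (centralizing Γ (g * gen Γ a * g⁻¹)) Set.univ := by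
  constructor
  · intro h g a
    obtain ⟨L, hL, hs⟩ := exists_isShortest (closedStar Γ a) g
    rw [conj_eq_conj hL]
    exact (not_separates_of_isShortest h a L hs).2
  · intro h
    have hpair : ∀ a c, a ≠ c → ¬ Γ.Adj a c →
        ¬ Separates Γ (Γ.neighborSet a ∩ Γ.neighborSet c) Set.univ := by
      intro a c hac hadj
      rw [← centralizing_conj_gen hac hadj]
      exact h _ _
    refine ⟨⟨?_, fun v w hvw => hpair v w ?_ ?_⟩, fun v => ?_⟩
    · intro x y
      by_contra hxy
      have h0 := hpair x y (by rintro rfl; exact hxy (SimpleGraph.Reachable.refl _))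
        fun h => hxy h.reachable
      have hempty : Γ.neighborSet x ∩ Γ.neighborSet y = ∅ := by
        rw [Set.eq_empty_iff_forall_notMem]
        rintro d ⟨h1, h2⟩
        exact hxy ((SimpleGraph.Adj.reachable h1).trans (SimpleGraph.Adj.reachable h2).symm)
      rw [hempty, not_separates_empty_univ_iff] at h0
      exact hxy (h0 x y)
    · rintro rfl
      simp at hvw
    · intro hadj
      rw [SimpleGraph.dist_eq_one_iff_adj.2 hadj] at hvw
      omega
    · rw [← centralizing_gen]
      simpa using h 1 v

end WeakType

section Extension

variable {V : Type u} {Γ : SimpleGraph V}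

/-! ### The extension graph and the projections of its vertices -/

theorem mem_liftedCopy_iff {z : Grp Γ} {y : ExtVertex Γ} :
    y ∈ liftedCopy Γ z ↔ ∃ b, y.1 = z * gen Γ b * z⁻¹ :=
  exists_congr fun _ => ⟨fun h => (congrArg Subtype.val h).symm, fun h => Subtype.ext h.symm⟩

theorem mem_closedStar_ext_iff {v y : ExtVertex Γ} :
    y ∈ closedStar (extensionGraph Γ) v ↔ Commute y.1 v.1 := by
  constructor
  · rintro (rfl | h)
    · exact Commute.refl _
    · exact h.2.symm
  · intro h
    by_cases e : y = v
    · exact Or.inl e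
    · exact Or.inr ⟨Ne.symm e, h.symm⟩

theorem vertexOfGeodesic_injective (x : Grp Γ) : Function.Injective (vertexOfGeodesic Γ x) :=
  fun _ _ h => label_eq_of_conj_eq (congrArg Subtype.val h)

theorem adj_vertexOfGeodesic_iff (x : Grp Γ) (b c : V) :
    (extensionGraph Γ).Adj (vertexOfGeodesic Γ x b) (vertexOfGeodesic Γ x c) ↔ Γ.Adj b c := by
  change _ ≠ _ ∧ Commute (x * gen Γ b * x⁻¹) (x * gen Γ c * x⁻¹) ↔ _
  rw [commute_conj_conj, commute_gen_gen_iff, (vertexOfGeodesic_injective x).ne_iff]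
  constructor
  · rintro ⟨h1, h2 | h2⟩
    exacts [absurd h2 h1, h2.symm]
  · exact fun h => ⟨h.ne, Or.inr h.symm⟩

/-- The vertices of `(F(Γ))ₓ` in the star of `v` are labelled by the generators commuting with
`x⁻¹vx`. -/
theorem separates_liftedCopy_iff (x : Grp Γ) (v : ExtVertex Γ) :
    Separates (extensionGraph Γ) (closedStar (extensionGraph Γ) v) (liftedCopy Γ x) ↔
      Separates Γ (centralizing Γ (x⁻¹ * v.1 * x)) Set.univ := by
  have hmem : ∀ b, vertexOfGeodesic Γ x b ∈ closedStar (extensionGraph Γ) v ↔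
      b ∈ centralizing Γ (x⁻¹ * v.1 * x) := by
    intro b
    rw [mem_closedStar_ext_iff]
    change Commute (x * gen Γ b * x⁻¹) v.1 ↔ Commute (gen Γ b) (x⁻¹ * v.1 * x)
    constructor
    · intro h
      exact ((commute_conj_iff _ _ _).1 h.symm).symm
    · intro h
      exact ((commute_conj_iff _ _ _).2 h.symm).symm
  let f : (Set.univ \ centralizing Γ (x⁻¹ * v.1 * x) : Set V) →
      (liftedCopy Γ x \ closedStar (extensionGraph Γ) v : Set (ExtVertex Γ)) :=
    fun b => ⟨vertexOfGeodesic Γ x b, ⟨b, rfl⟩, fun h => b.2.2 ((hmem b).1 h)⟩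
  have hf : Function.Bijective f := by
    constructor
    · intro b c h
      exact Subtype.ext (vertexOfGeodesic_injective x (congrArg Subtype.val h))
    · rintro ⟨_, ⟨b, rfl⟩, hb⟩
      exact ⟨⟨b, trivial, fun h => hb ((hmem b).2 h)⟩, rfl⟩
  let i : Γ.induce (Set.univ \ centralizing Γ (x⁻¹ * v.1 * x)) ≃g
      (extensionGraph Γ).induce (liftedCopy Γ x \ closedStar (extensionGraph Γ) v) :=
    ⟨Equiv.ofBijective f hf, fun {b c} => adj_vertexOfGeodesic_iff x b c⟩
  exact not_congr i.preconnected_iff.symm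

theorem exists_separates_liftedCopy_iff :
    (¬ ∃ (x : Grp Γ) (v : ExtVertex Γ),
      Separates (extensionGraph Γ) (closedStar (extensionGraph Γ) v) (liftedCopy Γ x)) ↔
    ∀ (g : Grp Γ) (a : V), ¬ Separates Γ (centralizing Γ (g * gen Γ a * g⁻¹)) Set.univ := by
  simp only [separates_liftedCopy_iff, not_exists]
  constructor
  · intro h g a
    simpa [vertexOfGeodesic] using h 1 (vertexOfGeodesic Γ g a)
  · rintro h x ⟨_, g, a, rfl⟩
    have := h (x⁻¹ * g) a
    rwa [mul_inv_rev, inv_inv, ← mul_assoc, mul_assoc x⁻¹, mul_assoc x⁻¹] at this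

namespace ExtVertex

/-- A point on some geodesic representing the vertex. -/
noncomputable def base (y : ExtVertex Γ) : Grp Γ := y.2.choose

/-- The label of the geodesics representing the vertex. -/
noncomputable def label (y : ExtVertex Γ) : V := y.2.choose_spec.choose

theorem eq_conj (y : ExtVertex Γ) : y.1 = y.base * gen Γ y.label * y.base⁻¹ :=
  y.2.choose_spec.choose_spec

theorem mem_liftedCopy_iff (y : ExtVertex Γ) (z : Grp Γ) :
    y ∈ liftedCopy Γ z ↔ y.base⁻¹ * z ∈ std Γ (closedStar Γ y.label) := by
  rw [RAAG.mem_liftedCopy_iff, y.eq_conj]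
  constructor
  · rintro ⟨b, hb⟩
    exact (conj_eq_conj_iff.1 hb).2
  · exact fun h => ⟨y.label, conj_eq_conj h⟩

/-- The coordinate of the projection of the point `z` to a geodesic representing `v`. -/
noncomputable def proj (v : ExtVertex Γ) (z : Grp Γ) : ℤ := wall v.label (v.base⁻¹ * z)

theorem proj_mul (v : ExtVertex Γ) (z : Grp Γ) : v.proj (v.1 * z) = v.proj z + 1 := by
  rw [proj, proj, ← wall_gen_mul]
  congr 1
  conv_lhs => rw [v.eq_conj]
  group

/-- If `y` is not in the star of `v`, all geodesics representing `y` project to the same point of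
the geodesic of `v`. -/
theorem proj_eq {v y : ExtVertex Γ} (h : ¬ Commute v.1 y.1) {z z' : Grp Γ}
    (hz : y ∈ liftedCopy Γ z) (hz' : y ∈ liftedCopy Γ z') : v.proj z = v.proj z' := by
  rw [v.eq_conj, y.eq_conj] at h
  rw [mem_liftedCopy_iff] at hz hz'
  rw [proj, proj, wall_eq_of_not_commute h hz, wall_eq_of_not_commute h hz']

theorem mem_liftedCopy_base (y : ExtVertex Γ) : y ∈ liftedCopy Γ y.base := by
  rw [mem_liftedCopy_iff]
  simp

theorem exists_common {y y' : ExtVertex Γ} (h : Commute y.1 y'.1) :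
    ∃ z, y ∈ liftedCopy Γ z ∧ y' ∈ liftedCopy Γ z := by
  rw [y.eq_conj, y'.eq_conj] at h
  simpa only [mem_liftedCopy_iff] using exists_common_of_commute h

theorem exists_proj_ne {y y' : ExtVertex Γ}
    (h : ¬ ∃ z, y ∈ liftedCopy Γ z ∧ y' ∈ liftedCopy Γ z) :
    ∃ v : ExtVertex Γ, ¬ Commute v.1 y.1 ∧ ¬ Commute v.1 y'.1 ∧
      v.proj y.base ≠ v.proj y'.base := by
  simp only [mem_liftedCopy_iff] at h
  obtain ⟨k, c, h1, h2, h3⟩ := exists_wall_separating h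
  set v := vertexOfGeodesic Γ k c with hv
  obtain ⟨hc, hk⟩ := conj_eq_conj_iff.1 (v.eq_conj : k * gen Γ c * k⁻¹ = _)
  refine ⟨v, by rwa [y.eq_conj], by rwa [y'.eq_conj], fun e => h3 ?_⟩
  have key : ∀ z, wall c (k⁻¹ * z) = wall c (k⁻¹ * v.base) + v.proj z := by
    intro z
    rw [proj, ← hc, ← wall_mul_of_mem hk]
    congr 1
    group
  rw [key y.base, key y'.base, e]

theorem helly [Finite V] (y : V → ExtVertex Γ)
    (h : ∀ i j, ∃ z, y i ∈ liftedCopy Γ z ∧ y j ∈ liftedCopy Γ z) :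
    ∃ z, ∀ i, y i ∈ liftedCopy Γ z := by
  simp only [mem_liftedCopy_iff] at h ⊢
  exact RAAG.helly (fun i => (y i).base) (fun i => closedStar Γ (y i).label) h

end ExtVertex

/-! ### Maximal standard flats -/

theorem mem_standardSubcomplex {g h : Grp Γ} {K : Set V} :
    h ∈ standardSubcomplex Γ g K ↔ g⁻¹ * h ∈ std Γ K := Iff.rfl

theorem self_mem_standardSubcomplex (g : Grp Γ) (K : Set V) : g ∈ standardSubcomplex Γ g K := by
  rw [mem_standardSubcomplex]
  simp

theorem standardSubcomplex_eq {g h : Grp Γ} {K : Set V} (hh : h ∈ standardSubcomplex Γ g K) :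
    standardSubcomplex Γ g K = standardSubcomplex Γ h K := by
  ext z
  rw [mem_standardSubcomplex] at *
  rw [mem_standardSubcomplex, show g⁻¹ * z = (g⁻¹ * h) * (h⁻¹ * z) by group,
    Subgroup.mul_mem_cancel_left _ hh]

theorem standardSubcomplex_subset_iff {g : Grp Γ} {K L : Set V} :
    standardSubcomplex Γ g K ⊆ standardSubcomplex Γ g L ↔ K ⊆ L := by
  constructor
  · intro h a ha
    have := h (show g * gen Γ a ∈ standardSubcomplex Γ g K by
      rw [mem_standardSubcomplex]; simpa using gen_mem_std ha)
    rw [mem_standardSubcomplex] at this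
    exact gen_mem_std_iff.1 (by simpa using this)
  · exact fun h z hz => std_mono h hz

theorem isMaximalStandardFlat_iff {g : Grp Γ} {K : Set V} :
    IsMaximalStandardFlat Γ (standardSubcomplex Γ g K) ↔ Maximal Γ.IsClique K := by
  constructor
  · rintro ⟨⟨h, L, hL, e⟩, hmax⟩
    have hg : g ∈ standardSubcomplex Γ h L := e ▸ self_mem_standardSubcomplex g K
    rw [standardSubcomplex_eq hg] at e
    obtain rfl : K = L := Set.Subset.antisymm (standardSubcomplex_subset_iff.1 e.le)
      (standardSubcomplex_subset_iff.1 e.ge)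
    exact ⟨hL, fun M hM hKM => standardSubcomplex_subset_iff.1
      (hmax ⟨g, M, hM, rfl⟩ (standardSubcomplex_subset_iff.2 hKM))⟩
  · rintro ⟨hK, hmax⟩
    refine ⟨⟨g, K, hK, rfl⟩, ?_⟩
    rintro _ ⟨h, L, hL, rfl⟩ hsub
    have e := standardSubcomplex_eq (hsub (self_mem_standardSubcomplex g K))
    rw [e] at hsub
    change standardSubcomplex Γ h L ⊆ _
    rw [e]
    exact standardSubcomplex_subset_iff.2 (hmax hL (standardSubcomplex_subset_iff.1 hsub))

theorem IsMaximalStandardFlat.exists_eq {F : Set (Grp Γ)} (hF : IsMaximalStandardFlat Γ F)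
    {p : Grp Γ} (hp : p ∈ F) :
    ∃ K, Maximal Γ.IsClique K ∧ F = standardSubcomplex Γ p K := by
  obtain ⟨g, K, -, rfl⟩ := hF.1
  exact ⟨K, isMaximalStandardFlat_iff.1 hF, standardSubcomplex_eq hp⟩

theorem mem_closedStar_of_isClique {K : Set V} (hK : Γ.IsClique K) {b c : V} (hb : b ∈ K)
    (hc : c ∈ K) : b ∈ closedStar Γ c := by
  by_cases h : b = c
  · exact Or.inl h
  · exact Or.inr (hK hc hb (Ne.symm h))

theorem delta_standardSubcomplex {K : Set V} (hK : Γ.IsClique K) (g : Grp Γ) :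
    delta Γ (standardSubcomplex Γ g K) = vertexOfGeodesic Γ g '' K := by
  ext y
  constructor
  · rintro ⟨h, a, hsub, rfl⟩
    have hh := hsub (self_mem_standardSubcomplex h {a})
    rw [standardSubcomplex_eq hh, standardGeodesic, standardSubcomplex_subset_iff,
      Set.singleton_subset_iff] at hsub
    refine ⟨a, hsub, Subtype.ext (conj_eq_conj (std_mono ?_ (mem_standardSubcomplex.1 hh)))⟩
    exact fun b hb => mem_closedStar_of_isClique hK hb hsub
  · rintro ⟨a, ha, rfl⟩
    exact ⟨g, a, standardSubcomplex_subset_iff.2 (Set.singleton_subset_iff.2 ha), rfl⟩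

/-- A vertex of the extension complex commuting with all of `pKp⁻¹`, for a maximal clique `K`, lies
in `pKp⁻¹`: its label is in the star of all vertices in `K`, hence in `K`, and two conjugates of the
same generator commute only if they are equal. -/
theorem mem_image_of_forall_commute {K : Set V} (hK : Maximal Γ.IsClique K) (p : Grp Γ)
    (y : ExtVertex Γ) (hy : ∀ b ∈ K, Commute (p * gen Γ b * p⁻¹) y.1) :
    y ∈ vertexOfGeodesic Γ p '' K := by
  by_cases hd : y.label ∈ K
  swap
  · exfalso
    refine hd (hK.2 (y := insert y.label K) ?_ (Set.subset_insert _ _) (Set.mem_insert _ _))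
    refine hK.1.insert fun b hb hne => ?_
    obtain ⟨z, hz, hz'⟩ := ExtVertex.exists_common (y := vertexOfGeodesic Γ p b) (hy b hb)
    obtain ⟨c, hc⟩ := mem_liftedCopy_iff.1 hz
    obtain ⟨d, hd'⟩ := mem_liftedCopy_iff.1 hz'
    obtain rfl : b = c := label_eq_of_conj_eq hc
    rw [y.eq_conj] at hd'
    have e := label_eq_of_conj_eq hd'
    have h1 := hy b hb
    rw [show p * gen Γ b * p⁻¹ = _ from hc, y.eq_conj, hd', commute_conj_conj, ← e,
      commute_gen_gen_iff] at h1
    exact h1.resolve_left (Ne.symm hne)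
  · have h1 := hy _ hd
    rw [y.eq_conj] at h1
    obtain ⟨z, hz1, hz2⟩ := exists_common_of_commute h1
    have e : p * gen Γ y.label * p⁻¹ = y.base * gen Γ y.label * y.base⁻¹ :=
      (conj_eq_conj hz1).trans (conj_eq_conj hz2).symm
    exact ⟨y.label, hd, Subtype.ext (e.trans y.eq_conj.symm)⟩

end Extension

section Visible

variable {V : Type u} {Γ : SimpleGraph V}

/-! ### Visibility of automorphisms under the separation condition -/

theorem SimplicialIso.commute_iff
    (s : SimplicialIso (extensionComplex Γ) (extensionComplex Γ)) (y y' : ExtVertex Γ) :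
    Commute (s.toEquiv y).1 (s.toEquiv y').1 ↔ Commute y.1 y'.1 := by
  classical
  by_cases hne : y = y'
  · subst hne
    exact iff_of_true (Commute.refl _) (Commute.refl _)
  have hface : ∀ z z' : ExtVertex Γ, z ≠ z' →
      (({z, z'} : Finset (ExtVertex Γ)) ∈ (extensionComplex Γ).faces ↔ Commute z.1 z'.1) := by
    intro z z' hz
    change (_ ∧ (extensionGraph Γ).IsClique _) ↔ _
    rw [Finset.coe_pair, SimpleGraph.isClique_pair]
    exact ⟨fun h => (h.2 hz).2, fun h => ⟨⟨z, by simp⟩, fun _ => ⟨hz, h⟩⟩⟩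
  rw [← hface y y' hne, ← s.map_mem_faces, ← hface _ _ (s.toEquiv.injective.ne hne)]
  simp [Finset.map_insert]

/-- Along a path outside of the star of `v` the projection to the geodesic of `v` is constant. -/
theorem proj_base_eq_of_adj {v y y' : ExtVertex Γ} (h : ¬ Commute v.1 y.1)
    (h' : ¬ Commute v.1 y'.1) (hadj : Commute y.1 y'.1) : v.proj y.base = v.proj y'.base := by
  obtain ⟨z, hz, hz'⟩ := ExtVertex.exists_common hadj
  rw [ExtVertex.proj_eq h y.mem_liftedCopy_base hz, ExtVertex.proj_eq h' hz' y'.mem_liftedCopy_base]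

/-- If no star separates a lifted copy, every automorphism `s` is visible. A hyperplane separating
the parallel sets of two vertices of `s((F(Γ))ₚ)` is excluded, because the image under `s` of a path
in `(F(Γ))ₚ` avoiding a star has constant projection. So these parallel sets meet pairwise, and by
the Helly property they have a common point. -/
theorem isVisible_of_not_separates [Finite V]
    (h : ¬ ∃ (x : Grp Γ) (v : ExtVertex Γ),
      Separates (extensionGraph Γ) (closedStar (extensionGraph Γ) v) (liftedCopy Γ x))
    (s : SimplicialIso (extensionComplex Γ) (extensionComplex Γ)) : IsVisible s := by
  intro p
  have hpair : ∀ i j : V, ∃ z, s.toEquiv (vertexOfGeodesic Γ p i) ∈ liftedCopy Γ z ∧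
      s.toEquiv (vertexOfGeodesic Γ p j) ∈ liftedCopy Γ z := by
    intro i j
    by_contra hcon
    obtain ⟨v, hi, hj, hne⟩ := ExtVertex.exists_proj_ne hcon
    set v' := s.toEquiv.symm v with hv'
    have hv : v = s.toEquiv v' := by simp [hv']
    have hstar : ∀ y, y ∉ closedStar (extensionGraph Γ) v' ↔ ¬ Commute v.1 (s.toEquiv y).1 := by
      intro y
      rw [mem_closedStar_ext_iff, hv, s.commute_iff]
      exact not_congr ⟨Commute.symm, Commute.symm⟩
    have hsep := (not_separates_iff _ _ _).1 (fun hs => h ⟨p, v', hs⟩)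
    have hjoin := hsep (vertexOfGeodesic Γ p i) ⟨⟨i, rfl⟩, (hstar _).2 hi⟩
      (vertexOfGeodesic Γ p j) ⟨⟨j, rfl⟩, (hstar _).2 hj⟩
    refine hne ?_
    clear hne hcon hj
    generalize vertexOfGeodesic Γ p j = y at hjoin
    induction hjoin with
    | refl => rfl
    | tail _ hbc ih =>
      rw [ih]
      exact proj_base_eq_of_adj ((hstar _).1 hbc.2.1.2) ((hstar _).1 hbc.2.2.2)
        ((s.commute_iff _ _).2 hbc.1.2)
  obtain ⟨q, hq⟩ := ExtVertex.helly _ hpair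
  choose κ hκ using fun i => hq i
  refine ⟨q, fun F hF hp => ?_⟩
  obtain ⟨K, hK, rfl⟩ := hF.exists_eq hp
  have hcomm : ∀ i j, Commute (gen Γ i) (gen Γ j) ↔ Commute (gen Γ (κ i)) (gen Γ (κ j)) := by
    intro i j
    rw [← commute_conj_conj p (gen Γ i), ← commute_conj_conj q (gen Γ (κ i))]
    have := s.commute_iff (vertexOfGeodesic Γ p i) (vertexOfGeodesic Γ p j)
    rw [← hκ, ← hκ] at this
    exact this.symm
  have himage : vertexOfGeodesic Γ q '' (κ '' K) =
      s.toEquiv '' (vertexOfGeodesic Γ p '' K) := by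
    simp only [Set.image_image, hκ]
  have hclique : Γ.IsClique (κ '' K) := by
    rintro _ ⟨i, hi, rfl⟩ _ ⟨j, hj, rfl⟩ hne
    have h1 := (hcomm i j).1 (commute_of_mem_closedStar (mem_closedStar_of_isClique hK.1 hi hj))
    exact ((commute_gen_gen_iff.1 h1).resolve_left hne).symm
  have hmax : Maximal Γ.IsClique (κ '' K) := by
    refine ⟨hclique, fun L hL hKL e he => ?_⟩
    have hmem : s.toEquiv.symm (vertexOfGeodesic Γ q e) ∈ vertexOfGeodesic Γ p '' K := by
      refine mem_image_of_forall_commute hK p _ fun b hb => ?_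
      change Commute (vertexOfGeodesic Γ p b).1 _
      rw [← s.commute_iff, Equiv.apply_symm_apply, ← hκ]
      exact (commute_conj_conj _ _ _).2
        (commute_of_mem_closedStar (mem_closedStar_of_isClique hL (hKL ⟨b, hb, rfl⟩) he))
    have h2 : vertexOfGeodesic Γ q e ∈ vertexOfGeodesic Γ q '' (κ '' K) := by
      rw [himage]
      exact ⟨_, hmem, by simp⟩
    exact (vertexOfGeodesic_injective q).mem_set_image.1 h2
  refine ⟨standardSubcomplex Γ q (κ '' K), isMaximalStandardFlat_iff.2 hmax, ?_,
    self_mem_standardSubcomplex _ _⟩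
  rw [delta_standardSubcomplex hclique, delta_standardSubcomplex hK.1, himage]

/-! ### An invisible automorphism for a separating star -/

/-- An involution of the vertices of `P(Γ)` preserving commutation is a simplicial automorphism. -/
noncomputable def simplicialIsoOfInvolutive (f : ExtVertex Γ → ExtVertex Γ)
    (hf : Function.Involutive f) (hc : ∀ y y', Commute y.1 y'.1 → Commute (f y).1 (f y').1) :
    SimplicialIso (extensionComplex Γ) (extensionComplex Γ) where
  toEquiv := hf.toPerm f
  map_mem_faces := by
    intro t
    have hadj : ∀ y y', (extensionGraph Γ).Adj (f y) (f y') ↔ (extensionGraph Γ).Adj y y' := by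
      intro y y'
      refine and_congr hf.injective.ne_iff ⟨fun h => ?_, hc y y'⟩
      have := hc _ _ h
      rwa [hf, hf] at this
    change (_ ∧ _) ↔ (_ ∧ _)
    refine and_congr Finset.map_nonempty ?_
    rw [Finset.coe_map]
    constructor
    · intro h y hy y' hy' hne
      exact (hadj y y').1 (h ⟨y, hy, rfl⟩ ⟨y', hy', rfl⟩ (hf.injective.ne hne))
    · rintro h _ ⟨y, hy, rfl⟩ _ ⟨y', hy', rfl⟩ hne
      exact (hadj y y').2 (h hy hy' fun e => hne (by rw [e]))

/-- Given a union `D` of components of `Γ \ C`, there is a function on `X(Γ)` changing exactly along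
the edges with a label in `D` which leave (`+1`) or enter (`-1`) the subcomplex `⟨C⟩`. It is the
indicator function of the part of `X(Γ)` on the side of `D` from `⟨C⟩`. -/
theorem exists_side (C D : Set V) (hCD : Disjoint C D)
    (hD : ∀ b c, Γ.Adj b c → b ∉ C → c ∉ C → (b ∈ D ↔ c ∈ D)) :
    ∃ f : Grp Γ → ℤ, f 1 = 0 ∧ ∀ z b, f (z * gen Γ b) = f z + D.indicator 1 b *
      ((std Γ C : Set (Grp Γ)).indicator 1 z -
        (std Γ C : Set (Grp Γ)).indicator 1 (z * gen Γ b)) := by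
  classical
  refine exists_potential _ fun z b c hbc => ?_
  have e : z * gen Γ b * gen Γ c = z * gen Γ c * gen Γ b := by
    rw [mul_assoc, (commute_gen_of_adj hbc).eq, mul_assoc]
  have hI : ∀ z, ∀ b ∈ C, (std Γ C : Set (Grp Γ)).indicator (1 : Grp Γ → ℤ) (z * gen Γ b) =
      (std Γ C : Set (Grp Γ)).indicator 1 z := fun z b hb => by
    simp only [Set.indicator, SetLike.mem_coe, Subgroup.mul_mem_cancel_right _ (gen_mem_std hb),
      Pi.one_apply]
  have hχ : ∀ b ∈ C, D.indicator (1 : V → ℤ) b = 0 := fun b hb =>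
    Set.indicator_of_notMem (Set.disjoint_left.1 hCD hb) _
  rw [e]
  by_cases hb : b ∈ C
  · rw [hχ b hb, hI _ b hb, hI _ b hb]
    ring
  · by_cases hc : c ∈ C
    · rw [hχ c hc, ← e, hI _ c hc, hI _ c hc]
      ring
    · have : D.indicator (1 : V → ℤ) b = D.indicator 1 c := by
        simp only [Set.indicator, hD b c hbc hb hc, Pi.one_apply]
      rw [this]
      ring

/-- A union `D` of components of `Γ \ C`, where `C` is the set of vertices of `Γ` commuting with `v`,
extends to a locally constant function on the vertices of `P(Γ)` outside of the star of `v`. -/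
theorem exists_locally_constant (v : ExtVertex Γ) (D : Set V)
    (hCD : Disjoint (centralizing Γ v.1) D)
    (hD : ∀ b c, Γ.Adj b c → b ∉ centralizing Γ v.1 → c ∉ centralizing Γ v.1 →
      (b ∈ D ↔ c ∈ D)) :
    ∃ F : ExtVertex Γ → ℤ,
      (∀ y y', ¬ Commute v.1 y.1 → ¬ Commute v.1 y'.1 → Commute y.1 y'.1 → F y = F y') ∧
      ∀ b ∉ centralizing Γ v.1, F (vertexOfGeodesic Γ 1 b) = D.indicator 1 b := by
  classical
  obtain ⟨f, hf1, hf⟩ := exists_side (Γ := Γ) _ D hCD hD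
  set C := centralizing Γ v.1 with hC
  set I : Grp Γ → ℤ := (std Γ C : Set (Grp Γ)).indicator 1 with hIdef
  set χ : V → ℤ := D.indicator 1 with hχdef
  have hcent : ∀ k ∈ std Γ C, Commute v.1 k := by
    intro k hk
    refine std_induction hk (Commute.one_right _) fun z _ c hc => ?_
    have hvc : Commute v.1 (gen Γ c) := Commute.symm hc
    exact ⟨fun h => h.mul_right hvc, fun h => by simpa using h.mul_right hvc.inv_right⟩
  -- a parallel set meeting `⟨C⟩` has its label outside `C`
  have hlab : ∀ (y : ExtVertex Γ) z b, ¬ Commute v.1 y.1 → y.1 = z * gen Γ b * z⁻¹ →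
      z ∈ std Γ C → b ∉ C := by
    intro y z b hy e hz hb
    refine hy ?_
    rw [e]
    have hvb : Commute v.1 (gen Γ b) := Commute.symm hb
    exact ((hcent z hz).mul_right hvb).mul_right (hcent z hz).inv_right
  have hχeq : ∀ b c, b ∈ closedStar Γ c → b ∉ C → c ∉ C → χ b = χ c := by
    rintro b c (rfl | h) hb hc
    · rfl
    · simp only [hχdef, Set.indicator, hD c b h hc hb, Pi.one_apply]
  have hconst : ∀ (y : ExtVertex Γ) z b, ¬ Commute v.1 y.1 → y.1 = z * gen Γ b * z⁻¹ →
      ∀ w ∈ std Γ (closedStar Γ b), f (z * w) + χ b * I (z * w) = f z + χ b * I z := by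
    intro y z b hy e w hw
    refine std_induction hw (by simp) fun w hw c hc => ?_
    suffices h : f (z * (w * gen Γ c)) + χ b * I (z * (w * gen Γ c)) =
        f (z * w) + χ b * I (z * w) by rw [h]
    rw [← mul_assoc, hf]
    have hmem : ∀ u ∈ std Γ (closedStar Γ b), z * u ∈ std Γ C → b ∉ C := fun u hu hzu =>
      hlab y _ b hy (by rw [e]; exact conj_eq_conj (by simpa using hu)) hzu
    by_cases hcC : c ∈ C
    · have h1 : I (z * w * gen Γ c) = I (z * w) := by
        simp only [hIdef, Set.indicator, SetLike.mem_coe,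
          Subgroup.mul_mem_cancel_right _ (gen_mem_std hcC), Pi.one_apply]
      rw [h1]
      ring
    · by_cases hb : b ∈ C
      · have h1 : I (z * w) = 0 :=
          Set.indicator_of_notMem (fun h => hmem w hw h hb) _
        have h2 : I (z * w * gen Γ c) = 0 :=
          Set.indicator_of_notMem
            (fun h => hmem (w * gen Γ c) (mul_mem hw (gen_mem_std hc)) (by simpa [mul_assoc] using h)
              hb) _
        rw [h1, h2]
        ring
      · rw [hχeq c b hc hcC hb]
        ring
  have hF : ∀ (y : ExtVertex Γ) z b, ¬ Commute v.1 y.1 → y.1 = z * gen Γ b * z⁻¹ →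
      f y.base + χ y.label * I y.base = f z + χ b * I z := by
    intro y z b hy e
    obtain ⟨hb, hz⟩ := conj_eq_conj_iff.1 (y.eq_conj.symm.trans e)
    rw [← hb, ← hconst y y.base y.label hy y.eq_conj _ hz, mul_inv_cancel_left]
  refine ⟨fun y => f y.base + χ y.label * I y.base, fun y y' hy hy' hc => ?_, fun b hb => ?_⟩
  · obtain ⟨z, hz, hz'⟩ := ExtVertex.exists_common hc
    obtain ⟨b, hb⟩ := mem_liftedCopy_iff.1 hz
    obtain ⟨b', hb'⟩ := mem_liftedCopy_iff.1 hz'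
    simp only
    rw [hF y z b hy hb, hF y' z b' hy' hb']
    by_cases hzC : z ∈ std Γ C
    · rw [hb, hb', commute_conj_conj, commute_gen_gen_iff] at hc
      rw [hχeq b b' hc (hlab y z b hy hb hzC) (hlab y' z b' hy' hb' hzC)]
    · rw [show I z = 0 from Set.indicator_of_notMem hzC _]
      ring
  · simp only
    rw [hF (vertexOfGeodesic Γ 1 b) 1 b (fun h => hb ?_) rfl, hf1,
      show I 1 = 1 from Set.indicator_of_mem (one_mem (std Γ C)) _]
    · ring
    · have h' : Commute (gen Γ b) v.1 := by simpa [vertexOfGeodesic] using h.symm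
      exact h'

/-- Conjugation of a vertex of `P(Γ)` by an element of the group. -/
def ExtVertex.conj (g : Grp Γ) (y : ExtVertex Γ) : ExtVertex Γ :=
  ⟨g * y.1 * g⁻¹, by
    obtain ⟨_, h, a, rfl⟩ := y
    exact ⟨g * h, a, by group⟩⟩

theorem ExtVertex.conj_inv_conj (g : Grp Γ) (y : ExtVertex Γ) : (y.conj g).conj g⁻¹ = y :=
  Subtype.ext (by simp [conj, mul_assoc])

theorem ExtVertex.conj_conj_inv (g : Grp Γ) (y : ExtVertex Γ) : (y.conj g⁻¹).conj g = y :=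
  Subtype.ext (by simp [conj, mul_assoc])

theorem ExtVertex.conj_eq_self {g : Grp Γ} {y : ExtVertex Γ} (h : Commute g y.1) :
    y.conj g = y :=
  Subtype.ext (by simp [conj, h.eq])

theorem ExtVertex.mem_liftedCopy_conj {g z : Grp Γ} {y : ExtVertex Γ} (h : y ∈ liftedCopy Γ z) :
    y.conj g ∈ liftedCopy Γ (g * z) := by
  obtain ⟨b, rfl⟩ := h
  exact ⟨b, Subtype.ext (by simp [conj, vertexOfGeodesic, mul_assoc])⟩

/-- Let `B` be the set of vertices outside of the star of `v` on which a locally constant function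
is `1` and which project to a given point of the geodesic of `v`. The sets `B` and `vBv⁻¹` are
disjoint, so exchanging them by conjugation with `v`, and fixing all other vertices, is an
involution; it preserves commutation because no vertex of `B` commutes with one outside of `B` and
the star of `v`. -/
theorem exists_exchange (v : ExtVertex Γ) (F : ExtVertex Γ → ℤ) (n : ℤ)
    (hF : ∀ y y', ¬ Commute v.1 y.1 → ¬ Commute v.1 y'.1 → Commute y.1 y'.1 → F y = F y') :
    ∃ s : SimplicialIso (extensionComplex Γ) (extensionComplex Γ),
      (∀ y, ¬ Commute v.1 y.1 → v.proj y.base = n → F y = 1 → s.toEquiv y = y.conj v.1) ∧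
      ∀ y, v.proj y.base = n → F y ≠ 1 → s.toEquiv y = y := by
  classical
  let B : ExtVertex Γ → Prop := fun y => ¬ Commute v.1 y.1 ∧ v.proj y.base = n ∧ F y = 1
  have hcomm : ∀ y : ExtVertex Γ, Commute v.1 (y.conj v.1).1 ↔ Commute v.1 y.1 := by
    intro y
    rw [ExtVertex.conj, commute_conj_iff]
    simp
  have hproj : ∀ y : ExtVertex Γ, ¬ Commute v.1 y.1 →
      v.proj (y.conj v.1).base = v.proj y.base + 1 := by
    intro y hy
    rw [← ExtVertex.proj_mul]
    exact ExtVertex.proj_eq ((hcomm y).not.2 hy) (ExtVertex.mem_liftedCopy_base _)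
      (ExtVertex.mem_liftedCopy_conj y.mem_liftedCopy_base)
  have hdisj : ∀ y, B y → ¬ B (y.conj v.1) := by
    rintro y ⟨h1, h2, -⟩ ⟨-, h3, -⟩
    rw [hproj y h1] at h3
    omega
  have hB : ∀ y y', Commute y.1 y'.1 → ¬ Commute v.1 y'.1 → B y → B y' := by
    rintro y y' h hy' ⟨h1, h2, h3⟩
    exact ⟨hy', by rw [← proj_base_eq_of_adj h1 hy' h, h2], by rw [← hF y y' h1 hy' h, h3]⟩
  let s : ExtVertex Γ → ExtVertex Γ := fun y =>
    if B y then y.conj v.1 else if B (y.conj v.1⁻¹) then y.conj v.1⁻¹ else y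
  have hinv : Function.Involutive s := by
    intro y
    by_cases h1 : B y
    · have e : s y = y.conj v.1 := if_pos h1
      rw [e]
      simp only [s]
      rw [if_neg (hdisj y h1), ExtVertex.conj_inv_conj, if_pos h1]
    · by_cases h2 : B (y.conj v.1⁻¹)
      · have e : s y = y.conj v.1⁻¹ := by simp only [s]; rw [if_neg h1, if_pos h2]
        rw [e]
        simp only [s]
        rw [if_pos h2, ExtVertex.conj_conj_inv]
      · have e : s y = y := by simp only [s]; rw [if_neg h1, if_neg h2]
        rw [e, e]
  have hconj : ∀ (g : Grp Γ) (y y' : ExtVertex Γ), Commute y.1 y'.1 →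
      Commute (y.conj g).1 (y'.conj g).1 := fun g y y' h => (commute_conj_conj g _ _).2 h
  have hstar : ∀ y y' : ExtVertex Γ, Commute v.1 y.1 → Commute y.1 y'.1 →
      Commute y.1 (s y').1 := by
    intro y y' hy h
    simp only [s]
    split_ifs
    · have := hconj v.1 y y' h
      rwa [ExtVertex.conj_eq_self hy] at this
    · have := hconj v.1⁻¹ y y' h
      rwa [ExtVertex.conj_eq_self hy.inv_left] at this
    · exact h
  have hfix : ∀ y : ExtVertex Γ, Commute v.1 y.1 → s y = y := by
    intro y hy
    simp only [s]
    rw [ExtVertex.conj_eq_self hy, ExtVertex.conj_eq_self hy.inv_left, ite_self, ite_self]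
  have hnc : ∀ y : ExtVertex Γ, ¬ Commute v.1 y.1 → ¬ Commute v.1 (y.conj v.1⁻¹).1 := by
    intro y hy
    rw [← hcomm, ExtVertex.conj_conj_inv]
    exact hy
  have hs : ∀ y y' : ExtVertex Γ, Commute y.1 y'.1 → Commute (s y).1 (s y').1 := by
    intro y y' h
    by_cases hy : Commute v.1 y.1
    · rw [hfix y hy]
      exact hstar y y' hy h
    by_cases hy' : Commute v.1 y'.1
    · rw [hfix y' hy']
      exact (hstar y' y hy' h.symm).symm
    have i1 : B y ↔ B y' := ⟨hB y y' h hy', hB y' y h.symm hy⟩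
    have h' := hconj v.1⁻¹ y y' h
    have i2 : B (y.conj v.1⁻¹) ↔ B (y'.conj v.1⁻¹) :=
      ⟨hB _ _ h' (hnc y' hy'), hB _ _ h'.symm (hnc y hy)⟩
    simp only [s, i1, i2]
    split_ifs
    exacts [hconj _ _ _ h, h', h]
  refine ⟨simplicialIsoOfInvolutive s hinv hs, fun y h1 h2 h3 => if_pos ⟨h1, h2, h3⟩,
    fun y h2 h3 => ?_⟩
  change s y = y
  by_cases hy : Commute v.1 y.1
  · exact hfix y hy
  simp only [s]
  rw [if_neg fun h => h3 h.2.2, if_neg]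
  rintro ⟨h4, h5, -⟩
  have := hproj _ h4
  rw [ExtVertex.conj_conj_inv] at this
  omega

/-- Maximal cliques exist above every vertex of a finite graph. -/
theorem exists_maximal_isClique [Finite V] (b : V) : ∃ K, b ∈ K ∧ Maximal Γ.IsClique K := by
  obtain ⟨K, hbK, hK⟩ := Set.Finite.exists_le_maximal (s := {K : Set V | Γ.IsClique K})
    (Set.toFinite _) (a := {b}) (by simp)
  exact ⟨K, hbK rfl, hK⟩

/-- A visible automorphism maps the lifted copy at `p` into a single lifted copy. -/
theorem IsVisible.exists_liftedCopy [Finite V]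
    {s : SimplicialIso (extensionComplex Γ) (extensionComplex Γ)} (hs : IsVisible s)
    (p : Grp Γ) : ∃ q, ∀ b, s.toEquiv (vertexOfGeodesic Γ p b) ∈ liftedCopy Γ q := by
  obtain ⟨q, hq⟩ := hs p
  refine ⟨q, fun b => ?_⟩
  obtain ⟨K, hb, hK⟩ := exists_maximal_isClique (Γ := Γ) b
  obtain ⟨F', hF', hd, hqF⟩ := hq _ (isMaximalStandardFlat_iff.2 hK)
    (self_mem_standardSubcomplex p K)
  obtain ⟨K', hK', rfl⟩ := hF'.exists_eq hqF
  rw [delta_standardSubcomplex hK'.1, delta_standardSubcomplex hK.1] at hd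
  obtain ⟨c, -, hc⟩ := hd.ge ⟨_, ⟨b, hb, rfl⟩, rfl⟩
  exact ⟨c, hc⟩

/-- If all automorphisms are visible, no star separates the lifted copy at `1`. Let `b` and `c` be
vertices of `Γ` separated by the star of `v`. The automorphism which conjugates `b`, but not `c`, by
`v` moves the parallel set of `b` by one step along the geodesic of `v`, while it fixes the parallel
set of `c`. So these sets project to different points, and they have no common point. -/
theorem not_separates_of_isVisible [Finite V]
    (h : ∀ s : SimplicialIso (extensionComplex Γ) (extensionComplex Γ), IsVisible s)
    (g : Grp Γ) (a : V) :
    ¬ Separates Γ (centralizing Γ (g * gen Γ a * g⁻¹)) Set.univ := by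
  set v := vertexOfGeodesic Γ g a with hv
  change ¬ Separates Γ (centralizing Γ v.1) Set.univ
  rw [not_separates_iff]
  rintro b ⟨-, hb⟩ c ⟨-, hc⟩
  by_contra hbc
  set U := Set.univ \ centralizing Γ v.1 with hU
  obtain ⟨F, hF, hFD⟩ := exists_locally_constant v {d | d ∈ U ∧ Joined Γ U b d}
    (Set.disjoint_left.2 fun d hd hd' => hd'.1.2 hd) (by
      intro d e hde hd he
      have hd' : d ∈ U := ⟨trivial, hd⟩
      have he' : e ∈ U := ⟨trivial, he⟩
      exact ⟨fun h => ⟨he', h.2.tail ⟨hde, hd', he'⟩⟩,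
        fun h => ⟨hd', h.2.tail ⟨hde.symm, he', hd'⟩⟩⟩)
  obtain ⟨s, hs1, hs2⟩ := exists_exchange v F (v.proj 1) hF
  obtain ⟨q, hq⟩ := (h s).exists_liftedCopy 1
  have hmem : ∀ d, vertexOfGeodesic Γ 1 d ∈ liftedCopy Γ 1 := fun d => ⟨d, rfl⟩
  have hcomm : ∀ d ∉ centralizing Γ v.1, ¬ Commute v.1 (vertexOfGeodesic Γ 1 d).1 := by
    intro d hd h
    have h' : Commute (gen Γ d) v.1 := by simpa [vertexOfGeodesic] using h.symm
    exact hd h'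
  have hp : ∀ d ∉ centralizing Γ v.1, v.proj (vertexOfGeodesic Γ 1 d).base = v.proj 1 :=
    fun d hd => ExtVertex.proj_eq (hcomm d hd) (ExtVertex.mem_liftedCopy_base _) (hmem d)
  have hFb : F (vertexOfGeodesic Γ 1 b) = 1 := by
    rw [hFD b hb]
    exact Set.indicator_of_mem (show b ∈ {d | d ∈ U ∧ Joined Γ U b d} from
      ⟨⟨trivial, hb⟩, Relation.ReflTransGen.refl⟩) _
  have hFc : F (vertexOfGeodesic Γ 1 c) ≠ 1 := by
    rw [hFD c hc, Set.indicator_of_notMem fun h => hbc h.2]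
    exact zero_ne_one
  have e1 := hq b
  rw [hs1 _ (hcomm b hb) (hp b hb) hFb] at e1
  have e2 := hq c
  rw [hs2 _ (hp c hc) hFc] at e2
  have q1 : v.proj q = v.proj 1 := ExtVertex.proj_eq (hcomm c hc) e2 (hmem c)
  have q2 : v.proj q = v.proj (v.1 * 1) := by
    refine ExtVertex.proj_eq (fun h => hcomm b hb ?_) e1 (ExtVertex.mem_liftedCopy_conj (hmem b))
    rw [ExtVertex.conj, commute_conj_iff] at h
    simpa using h
  rw [ExtVertex.proj_mul] at q2
  omega

end Visible

end RAAG

theorem theorem7p28 {V : Type*} [Finite V] (Γ : SimpleGraph V) :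
    List.TFAE
      [RAAG.IsWeakTypeI Γ,
        ¬ ∃ (x : RAAG.Grp Γ) (v : RAAG.ExtVertex Γ),
          RAAG.Separates (RAAG.extensionGraph Γ)
            (RAAG.closedStar (RAAG.extensionGraph Γ) v) (RAAG.liftedCopy Γ x),
        ∀ s : RAAG.SimplicialIso (RAAG.extensionComplex Γ) (RAAG.extensionComplex Γ),
          RAAG.IsVisible s] := by
  tfae_have 1 ↔ 2 := RAAG.isWeakTypeI_iff.trans RAAG.exists_separates_liftedCopy_iff.symm
  tfae_have 2 → 3 := RAAG.isVisible_of_not_separates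
  tfae_have 3 → 2 := fun h =>
    RAAG.exists_separates_liftedCopy_iff.2 (RAAG.not_separates_of_isVisible h)
  tfae_finish
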